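/- Let claims arrive according to a mixed Poisson process with structure distribution $L$ on $[0,\infty)$: the law of the arrival process is the $L(d\lambda)$-mixture of the laws of homogeneous Poisson processes with rate $\lambda$, i.e. of the processes whose inter-claim times are i.i.d. exponential with rate $\lambda$ (for $\lambda=0$ no claim ever arrives). Let $V_1,V_2,\dots\in[0,\infty]$ be the inter-claim times, $T_n=V_1+\dots+V_n$ the arrival times, $N(t)$ the number of $n\ge 1$ with $T_n\le t$, $X_1,X_2,\dots$ the (real-valued) claim sizes and $S(t)=\sum_{i=1}^{N(t)}X_i$. Let $\beta\ge 0$ and let $H_\ell,H_s$ be two cdfs. Assume that, given the arrival process, the claim sizes of the arriving claims are independent, and the size $X_i$ depends only on $V_i$, with $$\mathbf P[X_i\le y\mid V_i=v]=(1-e^{-\beta v})H_\ell(y)+e^{-\beta v}H_s(y).$$ Let $Y_\ell$, $Y_s$ be random variables with cdfs $H_\ell$, $H_s$. For $t,\lambda\ge0$ put $$\mathfrak A(t,\lambda,\beta)=\frac{\lambda}{(\beta+\lambda)^2}\Big(\beta-\beta e^{-(\beta+\lambda)t}+(\beta+\lambda)\lambda t\Big),$$ $$\mathfrak B(t,\lambda,\beta,\beta)=\frac{2\beta\lambda^2(\beta-2\lambda)}{(\beta+\lambda)^4}+t\,\frac{4\beta\lambda^3}{(\beta+\lambda)^3}+t^2\frac{\lambda^4}{(\beta+\lambda)^2}-\frac{2\beta\lambda^2\big(-2\lambda+\beta(1+t(\beta+\lambda))\big)}{(\beta+\lambda)^4e^{t(\beta+\lambda)}},$$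 $$\mathfrak B(t,\lambda,0,\beta)=-\frac{2\beta\lambda^2}{(\beta+\lambda)^3}+t\,\frac{2\beta\lambda^2}{(\beta+\lambda)^2}+t^2\frac{\lambda^3}{\beta+\lambda}+\frac{2\beta\lambda^2}{(\beta+\lambda)^3e^{t(\beta+\lambda)}},\qquad \mathfrak B(t,\lambda,0,0)=t^2\lambda^2,$$ all of which are read as $0$ when $\beta=\lambda=0$. For $\beta=0$ the formulas for $\mathfrak B(t,\lambda,\beta,\beta)$ and $\mathfrak B(t,\lambda,0,\beta)$ both reduce to $\mathfrak B(t,\lambda,0,0)=t^2\lambda^2$. Then, for every $t\ge0$, $$\begin{aligned} \mathbf E[S^2(t)]={}&\mathbf E[Y_\ell^2]\int_0^\infty\big(\lambda t-\mathfrak A(t,\lambda,\beta)\big)\,dL(\lambda)+\mathbf E[Y_s^2]\int_0^\infty\mathfrak A(t,\lambda,\beta)\,dL(\lambda)\\ &+(\mathbf E[Y_\ell])^2\int_0^\infty\big(\mathfrak B(t,\lambda,0,0)-2\mathfrak B(t,\lambda,0,\beta)+\mathfrak B(t,\lambda,\beta,\beta)\big)\,dL(\lambda)\\ &+2\,\mathbf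 E[Y_\ell]\,\mathbf E[Y_s]\int_0^\infty\big(\mathfrak B(t,\lambda,0,\beta)-\mathfrak B(t,\lambda,\beta,\beta)\big)\,dL(\lambda)\\ &+(\mathbf E[Y_s])^2\int_0^\infty\mathfrak B(t,\lambda,\beta,\beta)\,dL(\lambda), \end{aligned}$$ where the five integrands over $\lambda$ are nonnegative, in each of the following two senses: (a) if $\mathbf E[Y_\ell^2]$, $\mathbf E[Y_s^2]$ and $\int_0^\infty\lambda^2\,dL(\lambda)$ are finite, then $S^2(t)$ and the five integrands are integrable and the identity holds between real numbers; (b) if $Y_\ell,Y_s\ge0$ almost surely, then, without any moment assumption, the identity holds in $[0,\infty]$ (with $0\cdot\infty=0$). -/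

import Mathlib

open MeasureTheory ProbabilityTheory
open scoped NNReal ENNReal

noncomputable section

namespace AggregateClaims

variable {Ω : Type*}

/-- The arrival time `T_n = V_1 + ⋯ + V_n` of the `n`-th claim (`T_0 = 0`), where the inter-claim
times take values in `[0, ∞]`. Indices of sequences start at `0`: `V i` is the inter-claim time
preceding the claim number `i + 1`, which arrives at `arrivalTime V (i + 1)`. The value `∞` means
that the claim never arrives. -/
def arrivalTime (V : ℕ → Ω → ℝ≥0∞) (n : ℕ) (ω : Ω) : ℝ≥0∞ :=
  ∑ i ∈ Finset.range n, V i ω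

/-- The number `N(t)` of claims that arrive up to and including time `t ≥ 0`. -/
def claimCount (V : ℕ → Ω → ℝ≥0∞) (t : ℝ) (ω : Ω) : ℕ :=
  Set.ncard {i : ℕ | arrivalTime V (i + 1) ω ≤ ENNReal.ofReal t}

/-- The aggregate claim size `S(t) = X_1 + ⋯ + X_{N(t)}`; here `X i` is the size of the claim
number `i + 1`. -/
def aggregateClaim (V : ℕ → Ω → ℝ≥0∞) (X : ℕ → Ω → ℝ) (t : ℝ) (ω : Ω) : ℝ :=
  ∑ i ∈ Finset.range (claimCount V t ω), X i ω

/-- The sigma-algebra generated by the claim arrival process, i.e. by all inter-claim times. -/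
abbrev arrivalSigma (V : ℕ → Ω → ℝ≥0∞) : MeasurableSpace Ω :=
  MeasurableSpace.comap (fun ω i => V i ω) inferInstance

/-- The claim arrival process with inter-claim times `V` is a mixed Poisson process with structure
distribution `L` on `[0, ∞)`: its law is the `L`-mixture over `λ` of the laws of homogeneous
Poisson processes with rate `λ`, that is, of the processes whose inter-claim times are independent
and exponentially distributed with rate `λ` (identically `∞` if `λ = 0`). It is expressed through
the joint survival functions
`P[V_1 > v_1, …, V_n > v_n] = ∫ exp (-λ v_1) ⋯ exp (-λ v_n) dL(λ)`. -/
structure IsMixedPoisson [MeasurableSpace Ω] (P : Measure Ω) (L : Measure ℝ≥0)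
    (V : ℕ → Ω → ℝ≥0∞) : Prop where
  measurable : ∀ i, Measurable (V i)
  survival : ∀ (n : ℕ) (v : ℕ → ℝ≥0),
    P {ω | ∀ i < n, (v i : ℝ≥0∞) < V i ω} =
      ∫⁻ l, ENNReal.ofReal (∏ i ∈ Finset.range n, Real.exp (-((l : ℝ) * (v i : ℝ)))) ∂L

/-- The dependence model for the claim sizes: given the arrival process,
* the size of each arriving claim depends only on the preceding inter-claim time, and its
  conditional cdf is `y ↦ (1 - exp (-β v)) H_ℓ(y) + exp (-β v) H_s(y)` when that time equals `v`;
* the claim sizes are conditionally independent.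
Nothing is required of `X i` where the claim number `i + 1` never arrives. -/
structure IsBoudreaultModel [MeasurableSpace Ω] (P : Measure Ω) (V : ℕ → Ω → ℝ≥0∞)
    (X : ℕ → Ω → ℝ) (β : ℝ) (Hl Hs : Measure ℝ) : Prop where
  measurable : ∀ i, Measurable (X i)
  condCdf : ∀ (i : ℕ) (y : ℝ),
    P⟦{ω | X i ω ≤ y} | arrivalSigma V⟧
      =ᵐ[P.restrict {ω | arrivalTime V (i + 1) ω ≠ ∞}] fun ω =>
        (1 - Real.exp (-(β * (V i ω).toReal))) * cdf Hl y
          + Real.exp (-(β * (V i ω).toReal)) * cdf Hs y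
  condIndep : ∀ (s : Finset ℕ) (B : ℕ → Set ℝ), (∀ i, MeasurableSet (B i)) →
    P⟦⋂ i ∈ s, X i ⁻¹' B i | arrivalSigma V⟧
      =ᵐ[P.restrict {ω | ∀ i ∈ s, arrivalTime V (i + 1) ω ≠ ∞}] fun ω =>
        ∏ i ∈ s, (P⟦X i ⁻¹' B i | arrivalSigma V⟧) ω

/-- `𝔄(t, λ, β)`. -/
def frakA (t l β : ℝ) : ℝ :=
  l / (β + l) ^ 2 * (β - β / Real.exp ((β + l) * t) + (β + l) * l * t)

/-- `𝔅(t, λ, β, β)`. -/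
def frakBdiag (t l β : ℝ) : ℝ :=
  2 * β * l ^ 2 * (β - 2 * l) / (β + l) ^ 4
    + t * (4 * β * l ^ 3 / (β + l) ^ 3)
    + t ^ 2 * (l ^ 4 / (β + l) ^ 2)
    - 2 * β * l ^ 2 * (-2 * l + β * (1 + t * (β + l)))
        / ((β + l) ^ 4 * Real.exp (t * (β + l)))

/-- `𝔅(t, λ, 0, β)`. -/
def frakBmixed (t l β : ℝ) : ℝ :=
  -(2 * β * l ^ 2 / (β + l) ^ 3)
    + t * (2 * β * l ^ 2 / (β + l) ^ 2)
    + t ^ 2 * (l ^ 3 / (β + l))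
    + 2 * β * l ^ 2 / ((β + l) ^ 3 * Real.exp (t * (β + l)))

/-- `𝔅(t, λ, 0, 0)`. -/
def frakBzero (t l : ℝ) : ℝ := t ^ 2 * l ^ 2

/-- The coefficient `𝔅(t,λ,0,0) - 2 𝔅(t,λ,0,β) + 𝔅(t,λ,β,β)` of `(E[Y_ℓ])²`. -/
def coeffLL (t l β : ℝ) : ℝ := frakBzero t l - 2 * frakBmixed t l β + frakBdiag t l β

/-- The coefficient `𝔅(t,λ,0,β) - 𝔅(t,λ,β,β)` of `2 E[Y_ℓ] E[Y_s]`. -/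
def coeffLS (t l β : ℝ) : ℝ := frakBmixed t l β - frakBdiag t l β

end AggregateClaims

end

namespace AggregateClaims

/-! Almost surely finitely many claims arrive up to `t`, and then `S(t)²` is the sum of `X_i X_j`
over all ordered pairs of claims that have both arrived (`hasSum_sq_aggregateClaim`). Given the
arrival process, each size is a mixture of `H_ℓ` and `H_s` with weights `1 - exp (-β V_i)` and `exp
(-β V_i)`, and the sizes are independent. So the expectation of a term is a combination of moments
of `H_ℓ` and `H_s`. Its coefficients depend on the arrival process alone: they are expectations of
one weight (`singleWeight`, for `i = j`) or of a product of two (`pairWeight`, for `i ≠ j`) on the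
event of arrival by `t` (`setLIntegral_mul`, `setIntegral_mul`). It remains to sum these weights
over all claims or pairs.

By a π-system argument, the inter-claim times have the law of `E_i / λ`, with `E_i` independent unit
exponentials and `λ` of law `L` (`IsMixedPoisson.map_eq`). Fix `λ > 0` and put `u = λ t`, `b = β /
λ`. Integrating out `E_i`, the sum of the single discount weights is `∫₀ᵘ exp (-(b+1) x) g(u - x)
dx` with `g(v) = ∑ₙ P[Γₙ ≤ v] = 1 + v`, where `Γₙ` is a sum of `n` unit exponentials. For pairs, two
times are integrated out. A pair with larger index `n + 1` leaves `n` other times, and there are `2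
(n + 1)` such pairs, so the kernel is `∑ₙ 2 (n + 1) P[Γₙ ≤ v] = 2 + 4 v + v²`. The resulting
elementary integrals are `𝔄` and the two `𝔅`.

Only the weights `exp (-β v)` and `1` are computed this way. The sums with `1 - exp (-β v)` follow
by subtraction, which also shows that the integrands are nonnegative, since each is a sum of
nonnegative weights.

For nonnegative claims all interchanges are Tonelli. For signed claims, the same `[0, ∞]` identity
applied to `|X_i|` gives the absolute convergence needed to interchange sum and expectation. -/

/-! ### Erlang distribution functions and Poisson moments -/

lemma lintegral_expMeasure_one {f : ℝ → ℝ≥0∞} (hf : Measurable f) :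
    ∫⁻ x, f x ∂(expMeasure 1) = ∫⁻ x in Set.Ici 0, ENNReal.ofReal (Real.exp (-x)) * f x := by
  have h1 : expMeasure 1 = volume.withDensity (exponentialPDF 1) := rfl
  have hm : Measurable (exponentialPDF 1) :=
    (measurable_exponentialPDFReal 1).ennreal_ofReal
  rw [h1, lintegral_withDensity_eq_lintegral_mul _ hm hf, ← lintegral_indicator measurableSet_Ici]
  refine lintegral_congr fun x => ?_
  by_cases hx : 0 ≤ x
  · simp [Set.indicator, hx, exponentialPDF_of_nonneg hx]
  · simp [Set.indicator, hx, exponentialPDF_of_neg (not_le.1 hx)]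

instance isProbabilityMeasure_expMeasure_one : IsProbabilityMeasure (expMeasure 1) :=
  isProbabilityMeasure_expMeasure one_pos

/-- The probability that the sum of `n` independent unit exponential variables is at most `u`. -/
noncomputable def erlangCdf (n : ℕ) (u : ℝ) : ℝ≥0∞ :=
  if 0 ≤ u then ∑' k : ℕ, ENNReal.ofReal (Real.exp (-u) * u ^ (n + k) / (n + k).factorial) else 0

lemma measurable_erlangCdf (n : ℕ) : Measurable (erlangCdf n) := by
  unfold erlangCdf
  refine Measurable.ite measurableSet_Ici ?_ measurable_const
  exact Measurable.tsum fun k => by fun_prop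

lemma erlangCdf_zero (u : ℝ) : erlangCdf 0 u = if 0 ≤ u then 1 else 0 := by
  unfold erlangCdf
  split_ifs with hu
  · have h := (NormedSpace.expSeries_div_hasSum_exp (𝔸 := ℝ) u).mul_left (Real.exp (-u))
    rw [← Real.exp_eq_exp_ℝ, ← Real.exp_add, neg_add_cancel, Real.exp_zero] at h
    rw [← ENNReal.ofReal_one, ← h.tsum_eq,
      ENNReal.ofReal_tsum_of_nonneg (fun n => by positivity) h.summable]
    simp [mul_div_assoc]
  · rfl

/-- Integration of a truncated function against the unit exponential distribution. -/
lemma lintegral_expMeasure_one_sub {f w : ℝ → ℝ} (hf : Continuous f) (hw : Continuous w)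
    (hf0 : ∀ x, 0 ≤ x → 0 ≤ f x) (hw0 : ∀ x, 0 ≤ x → 0 ≤ w x) (u : ℝ) :
    ∫⁻ x, ENNReal.ofReal (f x) * (if 0 ≤ u - x then ENNReal.ofReal (w (u - x)) else 0)
        ∂(expMeasure 1) =
      if 0 ≤ u then ENNReal.ofReal (∫ x in (0 : ℝ)..u, Real.exp (-x) * f x * w (u - x)) else 0 := by
  rw [lintegral_expMeasure_one (by
    refine Measurable.mul (by fun_prop) (Measurable.ite ?_ (by fun_prop) measurable_const)
    exact measurableSet_le measurable_const (by fun_prop))]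
  split_ifs with hu
  · rw [intervalIntegral.integral_of_le hu, ← integral_Icc_eq_integral_Ioc,
      ofReal_integral_eq_lintegral_ofReal]
    · rw [← lintegral_indicator measurableSet_Ici, ← lintegral_indicator measurableSet_Icc]
      refine lintegral_congr fun x => ?_
      by_cases hx : 0 ≤ x
      · by_cases hxu : x ≤ u
        · have := hf0 x hx
          have := hw0 (u - x) (by linarith)
          simp only [Set.indicator, Set.mem_Ici, hx, Set.mem_Icc, hxu, and_self, if_true,
            sub_nonneg]
          rw [ENNReal.ofReal_mul (by positivity), ENNReal.ofReal_mul (by positivity), mul_assoc]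
        · simp [Set.indicator, hx, hxu]
      · simp [Set.indicator, hx]
    · exact (Continuous.integrableOn_Icc (by fun_prop))
    · filter_upwards [ae_restrict_mem measurableSet_Icc] with x hx
      have := hf0 x hx.1
      have := hw0 (u - x) (by linarith [hx.2])
      simp only [Pi.zero_apply]; positivity
  · rw [← lintegral_indicator measurableSet_Ici, ← lintegral_zero (μ := (volume : Measure ℝ))]
    refine lintegral_congr fun x => ?_
    by_cases hx : 0 ≤ x
    · have : ¬ x ≤ u := by linarith
      simp [Set.indicator, this]
    · simp [Set.indicator, hx]

/-- Convolution with one more exponential, done term by term on the Poisson tail: the exponentials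
combine to the constant `exp (-u)`, and integrating `(u - x) ^ (n + k)` raises the degree by one. -/
lemma erlangCdf_succ (n : ℕ) (u : ℝ) :
    erlangCdf (n + 1) u = ∫⁻ x, erlangCdf n (u - x) ∂(expMeasure 1) := by
  have h1 : ∀ x, erlangCdf n (u - x) = ∑' k : ℕ, ENNReal.ofReal 1 * (if 0 ≤ u - x then
      ENNReal.ofReal (Real.exp (-(u - x)) * (u - x) ^ (n + k) / (n + k).factorial) else 0) := by
    intro x
    unfold erlangCdf
    split_ifs <;> simp
  simp_rw [h1]
  rw [lintegral_tsum]
  swap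
  · intro k
    refine (Measurable.mul (by fun_prop) (Measurable.ite ?_ (by fun_prop)
      measurable_const)).aemeasurable
    exact measurableSet_le measurable_const (by fun_prop)
  have h2 := fun k : ℕ => lintegral_expMeasure_one_sub (f := fun _ => 1)
    (w := fun v => Real.exp (-v) * v ^ (n + k) / (n + k).factorial) continuous_const
    (by fun_prop) (fun _ _ => zero_le_one) (fun x hx => by positivity) u
  simp_rw [h2]
  unfold erlangCdf
  split_ifs with hu
  · refine tsum_congr fun k => ?_
    congr 1
    have h3 : ∀ x : ℝ, Real.exp (-x) * 1 * (Real.exp (-(u - x)) * (u - x) ^ (n + k)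
        / (n + k).factorial) = Real.exp (-u) / (n + k).factorial * (u - x) ^ (n + k) := by
      intro x
      have : Real.exp (-u) = Real.exp (-x) * Real.exp (-(u - x)) := by
        rw [← Real.exp_add]; congr 1; ring
      rw [this]; ring
    simp_rw [h3]
    rw [intervalIntegral.integral_const_mul,
      intervalIntegral.integral_comp_sub_left (fun y => y ^ (n + k)) u, sub_self, sub_zero,
      integral_pow, show n + 1 + k = n + k + 1 by ring, Nat.factorial_succ]
    push_cast
    have : ((n + k).factorial : ℝ) ≠ 0 := by positivity
    field_simp
    simp
  · simp

/-- Weighted sums of Erlang distribution functions are expectations for a Poisson variable. -/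
lemma tsum_mul_erlangCdf (w : ℕ → ℝ≥0∞) {u : ℝ} (hu : 0 ≤ u) :
    ∑' n, w n * erlangCdf n u = ∑' m : ℕ, (∑ n ∈ Finset.range (m + 1), w n) *
      ENNReal.ofReal (Real.exp (-u) * u ^ m / m.factorial) := by
  simp_rw [erlangCdf, if_pos hu, ← ENNReal.tsum_mul_left]
  -- Group the pairs `(n, k)` by `m = n + k`, the value of the Poisson variable.
  rw [← ENNReal.tsum_prod (f := fun n k => w n * ENNReal.ofReal (Real.exp (-u) * u ^ (n + k)
      / (n + k).factorial)), ← (Finset.HasAntidiagonal.sigmaAntidiagonalEquivProd (A := ℕ)).tsum_eq,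
    ENNReal.tsum_sigma']
  refine tsum_congr fun m => ?_
  rw [tsum_fintype, Finset.sum_mul, ← Finset.Nat.sum_antidiagonal_eq_sum_range_succ
    (fun n _ => w n * ENNReal.ofReal (Real.exp (-u) * u ^ m / m.factorial)),
    ← Finset.sum_coe_sort (Finset.HasAntidiagonal.antidiagonal m)]
  refine Finset.sum_congr rfl fun x _ => ?_
  have := Finset.HasAntidiagonal.mem_antidiagonal.1 x.2
  simp only [Finset.HasAntidiagonal.sigmaAntidiagonalEquivProd_apply]
  rw [this]

lemma hasSum_poisson (u : ℝ) :
    HasSum (fun m : ℕ => Real.exp (-u) * u ^ m / m.factorial) 1 := by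
  have h := (NormedSpace.expSeries_div_hasSum_exp (𝔸 := ℝ) u).mul_left (Real.exp (-u))
  rw [← Real.exp_eq_exp_ℝ, ← Real.exp_add, neg_add_cancel, Real.exp_zero] at h
  simpa [mul_div_assoc] using h

/-- The identity `E[N f(N - 1)] = u E[f(N)]` for a Poisson variable `N` of mean `u`. The truncated
subtraction at `m = 0` is harmless because of the factor `m`. -/
lemma hasSum_poisson_mul_shift (u : ℝ) {f : ℕ → ℝ} {a : ℝ}
    (hf : HasSum (fun m : ℕ => f m * (Real.exp (-u) * u ^ m / m.factorial)) a) :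
    HasSum (fun m : ℕ => (m * f (m - 1)) * (Real.exp (-u) * u ^ m / m.factorial)) (u * a) := by
  rw [← hasSum_nat_add_iff' 1]
  simp only [Finset.range_one, Finset.sum_singleton, Nat.cast_zero, zero_mul, sub_zero]
  refine (hf.mul_left u).congr_fun fun m => ?_
  rw [Nat.factorial_succ]
  push_cast
  have : (m.factorial : ℝ) ≠ 0 := by positivity
  have : (m : ℝ) + 1 ≠ 0 := by positivity
  field_simp
  ring

lemma hasSum_poisson_succ (u : ℝ) :
    HasSum (fun m : ℕ => (m + 1 : ℝ) * (Real.exp (-u) * u ^ m / m.factorial)) (1 + u) := by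
  have h0 := hasSum_poisson u
  have h1 := hasSum_poisson_mul_shift u (f := fun _ => 1) (by simpa using h0)
  rw [show 1 + u = u * 1 + 1 by ring]
  convert! h1.add h0 using 2; ring

lemma hasSum_poisson_succ_mul (u : ℝ) :
    HasSum (fun m : ℕ => ((m + 1) * (m + 2) : ℝ) * (Real.exp (-u) * u ^ m / m.factorial))
      (2 + 4 * u + u ^ 2) := by
  have h0 := hasSum_poisson u
  have h1 := hasSum_poisson_succ u
  have h2 := hasSum_poisson_mul_shift u (f := fun m => (m + 1 : ℝ)) h1
  -- `(m + 1)(m + 2) = m² + 3 (m + 1) - 1`.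
  have h3 := (h2.add (h1.mul_left 3)).add (h0.mul_left (-1))
  rw [show 2 + 4 * u + u ^ 2 = u * (1 + u) + 3 * (1 + u) + -1 * 1 by ring]
  refine h3.congr_fun fun m => ?_
  rcases m with _ | m
  · simp; ring
  · simp only [Nat.add_sub_cancel]; push_cast; ring

lemma tsum_erlangCdf (u : ℝ) :
    ∑' n, erlangCdf n u = if 0 ≤ u then ENNReal.ofReal (1 + u) else 0 := by
  split_ifs with hu
  · have h := tsum_mul_erlangCdf (fun _ => 1) hu
    simp only [one_mul] at h
    rw [h, ← (hasSum_poisson_succ u).tsum_eq,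
      ENNReal.ofReal_tsum_of_nonneg (fun m => by positivity) (hasSum_poisson_succ u).summable]
    refine tsum_congr fun m => ?_
    rw [ENNReal.ofReal_mul (by positivity)]
    congr 1
    rw [ENNReal.ofReal_add (by positivity) (by positivity)]
    simp
  · simp [erlangCdf, hu]

lemma tsum_two_mul_succ_mul_erlangCdf (u : ℝ) :
    ∑' n : ℕ, (2 * (n + 1) : ℝ≥0∞) * erlangCdf n u =
      if 0 ≤ u then ENNReal.ofReal (2 + 4 * u + u ^ 2) else 0 := by
  split_ifs with hu
  · rw [tsum_mul_erlangCdf _ hu, ← (hasSum_poisson_succ_mul u).tsum_eq,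
      ENNReal.ofReal_tsum_of_nonneg (fun m => by positivity) (hasSum_poisson_succ_mul u).summable]
    refine tsum_congr fun m => ?_
    rw [ENNReal.ofReal_mul (by positivity)]
    congr 1
    have : ∀ m : ℕ, ∑ n ∈ Finset.range (m + 1), (2 * (n + 1) : ℕ) = (m + 1) * (m + 2) := by
      intro m
      induction m with
      | zero => simp
      | succ k ih => rw [Finset.sum_range_succ, ih]; ring
    have h2 : ((m + 1) * (m + 2) : ℝ) = (((m + 1) * (m + 2) : ℕ) : ℝ) := by push_cast; ring
    rw [h2, ENNReal.ofReal_natCast, ← this]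
    push_cast; rfl
  · simp [erlangCdf, hu]

/-! ### Unit-rate arrivals: summing over claims and over pairs of claims -/

/-- The law of a sequence of independent unit exponential variables. -/
noncomputable def unitExp : Measure (ℕ → ℝ) := Measure.infinitePi fun _ => expMeasure 1

instance : IsProbabilityMeasure unitExp := by unfold unitExp; infer_instance

lemma iIndepFun_unitExp : iIndepFun (fun (i : ℕ) (x : ℕ → ℝ) => x i) unitExp :=
  iIndepFun_infinitePi (P := fun _ : ℕ => expMeasure 1) (X := fun _ x => x) (by fun_prop)

lemma map_eval_unitExp (i : ℕ) : unitExp.map (fun x => x i) = expMeasure 1 :=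
  Measure.infinitePi_map_eval (fun _ : ℕ => expMeasure 1) i

lemma lintegral_unitExp_of_indepFun {γ : Type*} [MeasurableSpace γ] {i : ℕ} {Y : (ℕ → ℝ) → γ}
    (hY : Measurable Y) (hind : IndepFun (fun x : ℕ → ℝ => x i) Y unitExp) {F : ℝ → γ → ℝ≥0∞}
    (hF : Measurable (Function.uncurry F)) :
    ∫⁻ x, F (x i) (Y x) ∂unitExp = ∫⁻ a, ∫⁻ x, F a (Y x) ∂unitExp ∂(expMeasure 1) := by
  have h := (indepFun_iff_map_prod_eq_prod_map_map (measurable_pi_apply i).aemeasurable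
    hY.aemeasurable).1 hind
  have : ∫⁻ x, F (x i) (Y x) ∂unitExp
      = ∫⁻ p, Function.uncurry F p ∂(unitExp.map fun x => (x i, Y x)) := by
    rw [lintegral_map hF (by fun_prop)]; rfl
  have hp := Measure.isProbabilityMeasure_map (μ := unitExp) hY.aemeasurable
  rw [this, h, lintegral_prod _ hF.aemeasurable, map_eval_unitExp]
  refine lintegral_congr fun a => ?_
  rw [lintegral_map (by exact hF.of_uncurry_left) hY]
  rfl

lemma indepFun_restrict_unitExp {i : ℕ} {s : Finset ℕ} (hi : i ∉ s) {γ : Type*}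
    [MeasurableSpace γ] {ψ : (s → ℝ) → γ} (hψ : Measurable ψ) :
    IndepFun (fun x : ℕ → ℝ => x i) (fun x => ψ fun k => x k) unitExp :=
  (iIndepFun_unitExp.indepFun_finset {i} s (Finset.disjoint_singleton_left.2 hi)
    (fun k => measurable_pi_apply k)).comp
    (φ := fun r : ({i} : Finset ℕ) → ℝ => r ⟨i, Finset.mem_singleton_self i⟩)
    (measurable_pi_apply _) hψ

lemma indepFun_sum_unitExp {i : ℕ} {s : Finset ℕ} (hi : i ∉ s) :
    IndepFun (fun x : ℕ → ℝ => x i) (fun x => ∑ k ∈ s, x k) unitExp := by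
  have h := indepFun_restrict_unitExp hi (ψ := fun r : s → ℝ => ∑ k : s, r k) (by fun_prop)
  simpa only [Finset.sum_coe_sort s] using h

lemma indepFun_pair_sum_unitExp {i j : ℕ} {s : Finset ℕ} (hi : i ∉ insert j s) :
    IndepFun (fun x : ℕ → ℝ => x i) (fun x => (x j, ∑ k ∈ s, x k)) unitExp := by
  have h := indepFun_restrict_unitExp hi
    (ψ := fun r : ↥(insert j s) → ℝ => (r ⟨j, Finset.mem_insert_self j s⟩,
      ∑ k : s, r ⟨k, Finset.mem_insert_of_mem k.2⟩)) (by fun_prop)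
  have e : ∀ x : ℕ → ℝ, ∑ k : s, x k = ∑ k ∈ s, x k := fun x => Finset.sum_coe_sort s x
  simpa only [e] using h

/-- The value `1` if `a ≤ u`, and `0` otherwise. -/
noncomputable def stepLE (u a : ℝ) : ℝ≥0∞ := if a ≤ u then 1 else 0

lemma measurable_stepLE : Measurable (Function.uncurry stepLE) :=
  Measurable.ite (measurableSet_le measurable_snd measurable_fst) measurable_const measurable_const

@[fun_prop]
lemma Measurable.stepLE {α : Type*} [MeasurableSpace α] {f g : α → ℝ} (hf : Measurable f)
    (hg : Measurable g) : Measurable fun x => stepLE (f x) (g x) :=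
  measurable_stepLE.comp (hf.prodMk hg)

lemma stepLE_add (u a b : ℝ) : stepLE u (a + b) = stepLE (u - a) b := by
  simp only [stepLE, le_sub_iff_add_le']

lemma lintegral_stepLE_sum (s : Finset ℕ) (u : ℝ) :
    ∫⁻ x, stepLE u (∑ k ∈ s, x k) ∂unitExp = erlangCdf s.card u := by
  induction s using Finset.induction_on generalizing u with
  | empty =>
    have : ∀ x : ℕ → ℝ, stepLE u (∑ k ∈ (∅ : Finset ℕ), x k) = if 0 ≤ u then 1 else 0 := fun x => by
      rw [Finset.sum_empty, stepLE]
    simp_rw [this]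
    rw [Finset.card_empty, erlangCdf_zero, lintegral_const, measure_univ, mul_one]
  | insert i s hi ih =>
    rw [Finset.card_insert_of_notMem hi, erlangCdf_succ]
    simp_rw [Finset.sum_insert hi]
    rw [lintegral_unitExp_of_indepFun (F := fun a r => stepLE u (a + r)) (by fun_prop)
      (indepFun_sum_unitExp hi) (by unfold Function.uncurry; fun_prop)]
    refine lintegral_congr fun a => ?_
    simp_rw [stepLE_add, ih]

lemma lintegral_mul_stepLE_sum {g : ℝ → ℝ≥0∞} (hg : Measurable g) (i : ℕ) (u : ℝ) :
    ∫⁻ x, g (x i) * stepLE u (∑ k ∈ Finset.range (i + 1), x k) ∂unitExp =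
      ∫⁻ a, g a * erlangCdf i (u - a) ∂(expMeasure 1) := by
  simp_rw [Finset.range_add_one, Finset.sum_insert (Finset.notMem_range_self (n := i))]
  rw [lintegral_unitExp_of_indepFun (F := fun a r => g a * stepLE u (a + r)) (by fun_prop)
      (indepFun_sum_unitExp Finset.notMem_range_self) (by unfold Function.uncurry; fun_prop)]
  refine lintegral_congr fun a => ?_
  rw [lintegral_const_mul _ (by fun_prop)]
  simp_rw [stepLE_add]
  rw [lintegral_stepLE_sum, Finset.card_range]

lemma lintegral_mul_mul_stepLE_sum {g h : ℝ → ℝ≥0∞} (hg : Measurable g) (hh : Measurable h)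
    {i j : ℕ} (hij : i ≠ j) (u : ℝ) :
    ∫⁻ x, g (x i) * h (x j) * stepLE u (∑ k ∈ Finset.range (max i j + 1), x k) ∂unitExp =
      ∫⁻ a, g a * ∫⁻ b, h b * erlangCdf (max i j - 1) (u - a - b) ∂(expMeasure 1)
        ∂(expMeasure 1) := by
  -- Of the `max i j + 1` times up to the later claim, those other than `i` and `j` enter only
  -- through their sum, which has `max i j - 1` terms.
  set s := ((Finset.range (max i j + 1)).erase i).erase j with hs
  have hj : j ∉ s := Finset.notMem_erase _ _
  have hi : i ∉ insert j s := by simp [hs, hij]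
  have hr : Finset.range (max i j + 1) = insert i (insert j s) := by
    rw [hs, Finset.insert_erase (by simp [hij.symm]), Finset.insert_erase (by simp)]
  have hc : s.card = max i j - 1 := by
    have := congrArg Finset.card hr
    rw [Finset.card_range, Finset.card_insert_of_notMem hi, Finset.card_insert_of_notMem hj] at this
    omega
  rw [hr, ← hc]
  simp_rw [Finset.sum_insert hi, Finset.sum_insert hj]
  rw [lintegral_unitExp_of_indepFun
    (F := fun a (r : ℝ × ℝ) => g a * h r.1 * stepLE u (a + (r.1 + r.2))) (by fun_prop)
    (indepFun_pair_sum_unitExp hi) (by unfold Function.uncurry; fun_prop)]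
  refine lintegral_congr fun a => ?_
  simp_rw [mul_assoc]
  rw [lintegral_const_mul _ (by fun_prop)]
  congr 1
  rw [lintegral_unitExp_of_indepFun
    (F := fun b (r : ℝ) => h b * stepLE u (a + (b + r))) (by fun_prop)
    (indepFun_sum_unitExp hj) (by unfold Function.uncurry; fun_prop)]
  refine lintegral_congr fun b => ?_
  rw [lintegral_const_mul _ (by fun_prop)]
  simp_rw [stepLE_add]
  rw [lintegral_stepLE_sum]

lemma tsum_tsum_lt (F : ℕ → ℝ≥0∞) :
    ∑' i : ℕ, ∑' j : ℕ, (if j < i then F (i - 1) else 0) = ∑' n : ℕ, (n + 1 : ℝ≥0∞) * F n := by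
  have h : ∀ i : ℕ, ∑' j : ℕ, (if j < i then F (i - 1) else 0) = i * F (i - 1) := by
    intro i
    rw [tsum_eq_sum (s := Finset.range i) (by intro j hj; simp at hj; simp [hj])]
    rw [Finset.sum_congr rfl (fun j hj => if_pos (Finset.mem_range.1 hj))]
    simp
  simp_rw [h]
  rw [tsum_eq_zero_add' ENNReal.summable]
  simp

/-- There are `n + 1` pairs on each side of the diagonal with larger index `n + 1`. Off the diagonal
the maximum is at least `1`, so the subtraction is genuine. -/
lemma tsum_offDiag_max (F : ℕ → ℝ≥0∞) :
    ∑' z : ℕ × ℕ, (if z.1 = z.2 then 0 else F (max z.1 z.2 - 1)) =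
      ∑' n : ℕ, (2 * (n + 1) : ℝ≥0∞) * F n := by
  have h : ∀ i j : ℕ, (if i = j then 0 else F (max i j - 1)) =
      (if j < i then F (i - 1) else 0) + if i < j then F (j - 1) else 0 := by
    intro i j
    rcases lt_trichotomy i j with h | h | h
    · simp [h, h.ne, h.not_gt, h.le]
    · simp [h]
    · simp [h, h.ne', h.not_gt, h.le]
  rw [ENNReal.tsum_prod']
  simp_rw [h, ENNReal.tsum_add]
  rw [tsum_tsum_lt, ENNReal.tsum_comm, tsum_tsum_lt, ← two_mul, ← ENNReal.tsum_mul_left]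
  simp_rw [mul_assoc]

lemma tsum_lintegral_mul_stepLE_sum {g : ℝ → ℝ≥0∞} (hg : Measurable g) (u : ℝ) :
    ∑' i : ℕ, ∫⁻ x, g (x i) * stepLE u (∑ k ∈ Finset.range (i + 1), x k) ∂unitExp =
      ∫⁻ a, g a * (if 0 ≤ u - a then ENNReal.ofReal (1 + (u - a)) else 0) ∂(expMeasure 1) := by
  simp_rw [lintegral_mul_stepLE_sum hg]
  have hm : ∀ n, Measurable fun a => erlangCdf n (u - a) :=
    fun n => (measurable_erlangCdf n).comp (by fun_prop)
  have hm' : ∀ n, AEMeasurable (fun a => g a * erlangCdf n (u - a)) (expMeasure 1) :=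
    fun n => (hg.mul (hm n)).aemeasurable
  rw [← lintegral_tsum hm']
  simp_rw [ENNReal.tsum_mul_left, tsum_erlangCdf]

lemma tsum_lintegral_mul_mul_stepLE_sum {g h : ℝ → ℝ≥0∞} (hg : Measurable g) (hh : Measurable h)
    (u : ℝ) :
    ∑' z : ℕ × ℕ, (if z.1 = z.2 then 0 else
      ∫⁻ x, g (x z.1) * h (x z.2) * stepLE u (∑ k ∈ Finset.range (max z.1 z.2 + 1), x k) ∂unitExp) =
      ∫⁻ a, g a * ∫⁻ b, h b * (if 0 ≤ u - a - b then
        ENNReal.ofReal (2 + 4 * (u - a - b) + (u - a - b) ^ 2) else 0) ∂(expMeasure 1)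
        ∂(expMeasure 1) := by
  have hm : ∀ n, Measurable fun p : ℝ × ℝ => erlangCdf n (u - p.1 - p.2) :=
    fun n => (measurable_erlangCdf n).comp (by fun_prop)
  have hm1 : ∀ n a, Measurable fun b : ℝ => erlangCdf n (u - a - b) :=
    fun n a => (measurable_erlangCdf n).comp (by fun_prop)
  have hm2 : ∀ n, Measurable fun a : ℝ => ∫⁻ b, h b * erlangCdf n (u - a - b) ∂(expMeasure 1) :=
    fun n => Measurable.lintegral_prod_right'
      (f := fun p : ℝ × ℝ => h p.2 * erlangCdf n (u - p.1 - p.2))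
      ((hh.comp measurable_snd).mul (hm n))
  have h1 : ∀ z : ℕ × ℕ, (if z.1 = z.2 then 0 else
      ∫⁻ x, g (x z.1) * h (x z.2) * stepLE u (∑ k ∈ Finset.range (max z.1 z.2 + 1), x k) ∂unitExp)
      = if z.1 = z.2 then 0 else (fun n => ∫⁻ a, g a * ∫⁻ b, h b * erlangCdf n (u - a - b)
        ∂(expMeasure 1) ∂(expMeasure 1)) (max z.1 z.2 - 1) := by
    intro z
    split_ifs with hz
    · rfl
    · exact lintegral_mul_mul_stepLE_sum hg hh hz u
  refine (tsum_congr h1).trans ((tsum_offDiag_max fun n => ∫⁻ a, g a * ∫⁻ b, h b * erlangCdf n (u - a - b)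
        ∂(expMeasure 1) ∂(expMeasure 1)).trans ?_)
  simp_rw [← tsum_two_mul_succ_mul_erlangCdf]
  have hm3 : ∀ n : ℕ, Measurable fun a => g a * ∫⁻ b, h b * erlangCdf n (u - a - b)
      ∂(expMeasure 1) := fun n => hg.mul (hm2 n)
  have hm4 : ∀ (a : ℝ) (n : ℕ), Measurable fun b => h b * erlangCdf n (u - a - b) :=
    fun a n => hh.mul (hm1 n a)
  calc ∑' n : ℕ, (2 * (n + 1) : ℝ≥0∞) * ∫⁻ a, g a * ∫⁻ b, h b * erlangCdf n (u - a - b)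
        ∂(expMeasure 1) ∂(expMeasure 1)
      = ∑' n : ℕ, ∫⁻ a, (2 * (n + 1) : ℝ≥0∞) * (g a * ∫⁻ b, h b * erlangCdf n (u - a - b)
        ∂(expMeasure 1)) ∂(expMeasure 1) :=
        tsum_congr fun n => (lintegral_const_mul _ (hm3 n)).symm
    _ = ∫⁻ a, ∑' n : ℕ, (2 * (n + 1) : ℝ≥0∞) * (g a * ∫⁻ b, h b * erlangCdf n (u - a - b)
        ∂(expMeasure 1)) ∂(expMeasure 1) :=
        (lintegral_tsum fun n => ((hm3 n).const_mul _).aemeasurable).symm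
    _ = _ := by
      refine lintegral_congr fun a => ?_
      simp_rw [mul_left_comm _ (g a), ENNReal.tsum_mul_left]
      congr 1
      calc ∑' n : ℕ, (2 * (n + 1) : ℝ≥0∞) * ∫⁻ b, h b * erlangCdf n (u - a - b) ∂(expMeasure 1)
          = ∑' n : ℕ, ∫⁻ b, (2 * (n + 1) : ℝ≥0∞) * (h b * erlangCdf n (u - a - b))
              ∂(expMeasure 1) :=
            tsum_congr fun n => (lintegral_const_mul _ (hm4 a n)).symm
        _ = ∫⁻ b, ∑' n : ℕ, (2 * (n + 1) : ℝ≥0∞) * (h b * erlangCdf n (u - a - b))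
              ∂(expMeasure 1) :=
            (lintegral_tsum fun n => ((hm4 a n).const_mul _).aemeasurable).symm
        _ = _ := by
          simp_rw [mul_left_comm _ (h _), ENNReal.tsum_mul_left]

/-! ### Closed forms of the kernel integrals -/

lemma integral_exp_mul_quadratic {c : ℝ} (hc : c ≠ 0) (A B C u : ℝ) :
    ∫ x in (0 : ℝ)..u, Real.exp (-(c * x)) * (A + B * (u - x) + C * (u - x) ^ 2) =
      ((A - (B - 2 * (C / c)) / c) / c + (B - 2 * (C / c)) / c * u + C / c * u ^ 2)
        - (A - (B - 2 * (C / c)) / c) / c * Real.exp (-(c * u)) := by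
  -- An antiderivative is sought as `-exp (-c x)` times a quadratic in `u - x`. Its coefficients
  -- solve the triangular system `C = c d`, `B = c e + 2 d`, `A = c a + e`.
  set d := C / c with hd
  set e := (B - 2 * d) / c with he
  set a := (A - e) / c with ha
  have h : ∀ x ∈ Set.uIcc 0 u, HasDerivAt
      (fun x => -(Real.exp (-(c * x)) * (a + e * (u - x) + d * (u - x) ^ 2)))
      (Real.exp (-(c * x)) * (A + B * (u - x) + C * (u - x) ^ 2)) x := by
    intro x _
    have h1 : HasDerivAt (fun x => -(c * x)) (-c) x := by
      simpa [Pi.neg_def] using ((hasDerivAt_id x).const_mul c).neg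
    have h2 : HasDerivAt (fun x => u - x) (-1) x := by
      simpa using (hasDerivAt_id x).const_sub u
    have h3 := ((h1.exp.mul (((h2.const_mul e).const_add a).add ((h2.pow 2).const_mul d)))).neg
    convert! h3 using 1
    have e1 : A = c * a + e := by rw [ha]; field_simp; ring
    have e2 : B = c * e + 2 * d := by rw [he]; field_simp; ring
    have e3 : C = c * d := by rw [hd]; field_simp
    simp only [Pi.add_apply, Pi.pow_apply]
    push_cast
    linear_combination (e1 + (u - x) * e2 + (u - x) ^ 2 * e3) * Real.exp (-(c * x))
  rw [intervalIntegral.integral_eq_sub_of_hasDerivAt h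
    ((by fun_prop : Continuous _).intervalIntegrable _ _)]
  simp
  ring

lemma exp_neg_mul_exp_neg (b x : ℝ) :
    Real.exp (-x) * Real.exp (-(b * x)) = Real.exp (-((b + 1) * x)) := by
  rw [← Real.exp_add]; congr 1; ring

lemma integral_frakA {b : ℝ} (hb : 0 ≤ b) (u : ℝ) :
    ∫ x in (0 : ℝ)..u, Real.exp (-x) * Real.exp (-(b * x)) * (1 + (u - x)) = frakA u 1 b := by
  have hc : b + 1 ≠ 0 := by positivity
  have h := integral_exp_mul_quadratic hc 1 1 0 u
  simp only [zero_mul, add_zero, one_mul] at h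
  simp_rw [exp_neg_mul_exp_neg]
  rw [h, frakA, Real.exp_neg]
  field_simp
  ring

/-- The integral `∫₀ˢ exp (-c y) (2 + 4 (s - y) + (s - y)²) dy` in closed form. -/
noncomputable def innerPair (c s : ℝ) : ℝ :=
  ((2 - (4 - 2 * (1 / c)) / c) / c + (4 - 2 * (1 / c)) / c * s + 1 / c * s ^ 2)
        - (2 - (4 - 2 * (1 / c)) / c) / c * Real.exp (-(c * s))

lemma integral_innerPair {b : ℝ} (hb : 0 ≤ b) (s : ℝ) :
    ∫ y in (0 : ℝ)..s, Real.exp (-y) * Real.exp (-(b * y)) * (2 + 4 * (s - y) + (s - y) ^ 2) =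
      innerPair (b + 1) s := by
  have hc : b + 1 ≠ 0 := by positivity
  have h := integral_exp_mul_quadratic hc 2 4 1 s
  simp only [one_mul] at h
  simp_rw [exp_neg_mul_exp_neg]
  exact h

lemma innerPair_nonneg {b s : ℝ} (hb : 0 ≤ b) (hs : 0 ≤ s) : 0 ≤ innerPair (b + 1) s := by
  rw [← integral_innerPair hb]
  refine intervalIntegral.integral_nonneg hs fun y hy => ?_
  have : 0 ≤ s - y := by linarith [hy.2]
  positivity

lemma continuous_innerPair (c : ℝ) : Continuous (innerPair c) := by
  unfold innerPair; fun_prop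

lemma innerPair_one (s : ℝ) : innerPair 1 s = 2 * s + s ^ 2 := by
  unfold innerPair; ring

lemma integral_frakBmixed {b : ℝ} (hb : 0 ≤ b) (u : ℝ) :
    ∫ x in (0 : ℝ)..u, Real.exp (-x) * Real.exp (-(b * x)) * innerPair 1 (u - x) =
      frakBmixed u 1 b := by
  have hc : b + 1 ≠ 0 := by positivity
  have h := integral_exp_mul_quadratic hc 0 2 1 u
  simp only [zero_add, one_mul] at h
  simp_rw [exp_neg_mul_exp_neg, innerPair_one]
  rw [h, frakBmixed, Real.exp_neg, mul_comm (b + 1) u]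
  field_simp
  ring

lemma integral_frakBdiag {b : ℝ} (hb : 0 ≤ b) (u : ℝ) :
    ∫ x in (0 : ℝ)..u, Real.exp (-x) * Real.exp (-(b * x)) * innerPair (b + 1) (u - x) =
      frakBdiag u 1 b := by
  have hc : b + 1 ≠ 0 := by positivity
  set c := b + 1 with hcdef
  have h := integral_exp_mul_quadratic hc ((2 - (4 - 2 * (1 / c)) / c) / c)
    ((4 - 2 * (1 / c)) / c) (1 / c) u
  -- The exponential part of `innerPair` merges with the outer factor into the constant `exp (-c
  -- u)`, whose integral produces the term in `t exp (-t (β + λ))`.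
  have e : ∀ x, Real.exp (-x) * Real.exp (-(b * x)) * innerPair c (u - x) =
      Real.exp (-(c * x)) * ((2 - (4 - 2 * (1 / c)) / c) / c
        + (4 - 2 * (1 / c)) / c * (u - x) + 1 / c * (u - x) ^ 2)
      - (2 - (4 - 2 * (1 / c)) / c) / c * Real.exp (-(c * u)) := by
    intro x
    have : Real.exp (-(c * u)) = Real.exp (-(c * x)) * Real.exp (-(c * (u - x))) := by
      rw [← Real.exp_add]; congr 1; ring
    rw [exp_neg_mul_exp_neg, innerPair, this]
    ring
  simp_rw [e]
  rw [intervalIntegral.integral_sub ((by fun_prop : Continuous _).intervalIntegrable _ _)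
    ((by fun_prop : Continuous _).intervalIntegrable _ _), h, intervalIntegral.integral_const,
    frakBdiag, ← hcdef, Real.exp_neg, mul_comm c u, smul_eq_mul]
  have hb' : b = c - 1 := by rw [hcdef]; ring
  rw [hb']
  field_simp
  ring

/-- The discount factor `exp (-b x)` as an extended nonnegative real. -/
noncomputable def expWeight (b x : ℝ) : ℝ≥0∞ := ENNReal.ofReal (Real.exp (-(b * x)))

@[fun_prop]
lemma measurable_expWeight (b : ℝ) : Measurable (expWeight b) := by unfold expWeight; fun_prop

/-- The sign is not visible in the closed form and is read off the integral; likewise for the two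
`𝔅` below. -/
lemma frakA_one_nonneg {b u : ℝ} (hb : 0 ≤ b) (hu : 0 ≤ u) : 0 ≤ frakA u 1 b := by
  rw [← integral_frakA hb]
  refine intervalIntegral.integral_nonneg hu fun y hy => ?_
  have : 0 ≤ u - y := by linarith [hy.2]
  positivity

lemma frakBmixed_one_nonneg {b u : ℝ} (hb : 0 ≤ b) (hu : 0 ≤ u) : 0 ≤ frakBmixed u 1 b := by
  rw [← integral_frakBmixed hb]
  refine intervalIntegral.integral_nonneg hu fun y hy => ?_
  have := innerPair_nonneg le_rfl (sub_nonneg.2 hy.2)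
  rw [zero_add] at this
  positivity

lemma frakBdiag_one_nonneg {b u : ℝ} (hb : 0 ≤ b) (hu : 0 ≤ u) : 0 ≤ frakBdiag u 1 b := by
  rw [← integral_frakBdiag hb]
  refine intervalIntegral.integral_nonneg hu fun y hy => ?_
  have := innerPair_nonneg hb (sub_nonneg.2 hy.2)
  positivity

lemma tsum_unitExp_expWeight {b u : ℝ} (hb : 0 ≤ b) (hu : 0 ≤ u) :
    ∑' i : ℕ, ∫⁻ x, expWeight b (x i) * stepLE u (∑ k ∈ Finset.range (i + 1), x k) ∂unitExp =
      ENNReal.ofReal (frakA u 1 b) := by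
  rw [tsum_lintegral_mul_stepLE_sum (measurable_expWeight b)]
  unfold expWeight
  rw [lintegral_expMeasure_one_sub (w := fun v => 1 + v) (by fun_prop) (by fun_prop)
    (fun x hx => by positivity) (fun x hx => by positivity), if_pos hu, integral_frakA hb]

lemma tsum_unitExp_expWeight_pair {b b' u : ℝ} (hb' : 0 ≤ b') (hu : 0 ≤ u) :
    ∑' z : ℕ × ℕ, (if z.1 = z.2 then 0 else ∫⁻ x, expWeight b (x z.1) * expWeight b' (x z.2) *
      stepLE u (∑ k ∈ Finset.range (max z.1 z.2 + 1), x k) ∂unitExp) =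
    ENNReal.ofReal (∫ x in (0 : ℝ)..u,
      Real.exp (-x) * Real.exp (-(b * x)) * innerPair (b' + 1) (u - x)) := by
  rw [tsum_lintegral_mul_mul_stepLE_sum (measurable_expWeight b) (measurable_expWeight b')]
  unfold expWeight
  have h : ∀ a, ∫⁻ y, ENNReal.ofReal (Real.exp (-(b' * y))) * (if 0 ≤ u - a - y then
      ENNReal.ofReal (2 + 4 * (u - a - y) + (u - a - y) ^ 2) else 0) ∂(expMeasure 1) =
      if 0 ≤ u - a then ENNReal.ofReal (innerPair (b' + 1) (u - a)) else 0 := by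
    intro a
    rw [lintegral_expMeasure_one_sub (w := fun v => 2 + 4 * v + v ^ 2) (by fun_prop) (by fun_prop)
      (fun x hx => by positivity) (fun x hx => by positivity), integral_innerPair hb']
  simp_rw [h]
  rw [lintegral_expMeasure_one_sub (by fun_prop) (continuous_innerPair _)
    (fun x hx => by positivity) (fun x hx => innerPair_nonneg hb' hx), if_pos hu]

/-! ### Change of time scale, and the case `β = 0` -/

/-- Measuring time in units of `1 / l` turns rate `l`, horizon `t` and discount rate `β` into `1`,
`l t` and `β / l`. -/
lemma frakA_scale {l : ℝ} (hl : 0 < l) {β : ℝ} (hβ : 0 ≤ β) (t : ℝ) :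
    frakA (l * t) 1 (β / l) = frakA t l β := by
  have h : (β / l + 1) * (l * t) = (β + l) * t := by field_simp
  have h2 : β + l ≠ 0 := by positivity
  have h3 : β / l + 1 = (β + l) / l := by field_simp
  unfold frakA
  rw [h, h3]
  field_simp

lemma frakBmixed_scale {l : ℝ} (hl : 0 < l) {β : ℝ} (hβ : 0 ≤ β) (t : ℝ) :
    frakBmixed (l * t) 1 (β / l) = frakBmixed t l β := by
  have h : l * t * (β / l + 1) = t * (β + l) := by field_simp
  have h2 : β + l ≠ 0 := by positivity
  have h3 : β / l + 1 = (β + l) / l := by field_simp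
  unfold frakBmixed
  rw [h, h3]
  field_simp

lemma frakBdiag_scale {l : ℝ} (hl : 0 < l) {β : ℝ} (hβ : 0 ≤ β) (t : ℝ) :
    frakBdiag (l * t) 1 (β / l) = frakBdiag t l β := by
  have h : l * t * (β / l + 1) = t * (β + l) := by field_simp
  have h2 : β + l ≠ 0 := by positivity
  have h3 : β / l + 1 = (β + l) / l := by field_simp
  unfold frakBdiag
  rw [h, h3]
  field_simp

lemma frakA_zero_right (t l : ℝ) : frakA t l 0 = l * t := by
  unfold frakA
  rcases eq_or_ne l 0 with rfl | h
  · simp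
  · simp only [zero_add, zero_div, sub_zero]; field_simp

lemma frakBmixed_zero_right (t l : ℝ) : frakBmixed t l 0 = frakBzero t l := by
  unfold frakBmixed frakBzero
  rcases eq_or_ne l 0 with rfl | h
  · simp
  · simp; field_simp; simp

lemma frakBdiag_zero_right (t l : ℝ) : frakBdiag t l 0 = frakBzero t l := by
  unfold frakBdiag frakBzero
  rcases eq_or_ne l 0 with rfl | h
  · simp
  · simp; field_simp; simp

/-! ### The mixed Poisson law as a mixture of scaled exponential sequences -/

/-- Independent exponential inter-claim times of rate `l`, obtained by scaling unit exponential
ones; they are almost surely infinite if `l = 0`. -/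
noncomputable def poissonTimes (l : ℝ≥0) (i : ℕ) (x : ℕ → ℝ) : ℝ≥0∞ := ENNReal.ofReal (x i) / l

lemma measurable_poissonTimes : Measurable fun (p : ℝ≥0 × (ℕ → ℝ)) i => poissonTimes p.1 i p.2 := by
  refine measurable_pi_lambda _ fun i => ?_
  unfold poissonTimes
  fun_prop

lemma lt_poissonTimes_iff (l v : ℝ≥0) (i : ℕ) (x : ℕ → ℝ) :
    (v : ℝ≥0∞) < poissonTimes l i x ↔ (l : ℝ) * v < x i := by
  unfold poissonTimes
  -- At rate zero, division in `[0, ∞]` gives `∞` for `x i > 0` and `0 / 0 = 0` otherwise, so the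
  -- equivalence persists.
  rcases eq_or_ne l 0 with rfl | hl
  · rcases lt_or_ge 0 (x i) with h | h
    · rw [ENNReal.coe_zero, ENNReal.div_zero (by simpa using h)]; simp [h]
    · rw [ENNReal.ofReal_of_nonpos h]; simp [h]
  · rw [ENNReal.lt_div_iff_mul_lt (by simp [hl]) (by simp), ← ENNReal.coe_mul,
      ENNReal.lt_ofReal_iff_toReal_lt ENNReal.coe_ne_top]
    simp [mul_comm]

lemma expMeasure_one_Ioi {a : ℝ} (ha : 0 ≤ a) :
    expMeasure 1 (Set.Ioi a) = ENNReal.ofReal (Real.exp (-a)) := by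
  rw [← Set.compl_Iic, prob_compl_eq_one_sub measurableSet_Iic, ← ofReal_cdf,
    cdf_expMeasure_eq one_pos, if_pos ha, one_mul, ← ENNReal.ofReal_one,
    ← ENNReal.ofReal_sub _ (by simpa using ha)]
  congr 1; ring

lemma generateFrom_survival : (MeasurableSpace.pi : MeasurableSpace (ℕ → ℝ≥0∞)) =
    MeasurableSpace.generateFrom {S | ∃ (s : Finset ℕ) (v : ℕ → ℝ≥0),
      S = {x | ∀ i ∈ s, (v i : ℝ≥0∞) < x i}} := by
  apply le_antisymm
  · refine iSup_le fun i => ?_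
    rw [← measurable_iff_comap_le]
    refine measurable_of_Ioi fun a => ?_
    induction a with
    | top => simp
    | coe a =>
      refine MeasurableSpace.measurableSet_generateFrom ⟨{i}, fun _ => a, ?_⟩
      ext x; simp
  · refine MeasurableSpace.generateFrom_le ?_
    rintro _ ⟨s, v, rfl⟩
    have : {x : ℕ → ℝ≥0∞ | ∀ i ∈ s, (v i : ℝ≥0∞) < x i}
        = ⋂ i ∈ s, {x | (v i : ℝ≥0∞) < x i} := by ext; simp
    rw [this]
    exact Finset.measurableSet_biInter s fun i _ =>
      measurableSet_lt measurable_const (measurable_pi_apply i)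

lemma isPiSystem_survival : IsPiSystem {S | ∃ (s : Finset ℕ) (v : ℕ → ℝ≥0),
      S = {x : ℕ → ℝ≥0∞ | ∀ i ∈ s, (v i : ℝ≥0∞) < x i}} := by
  rintro _ ⟨s, v, rfl⟩ _ ⟨s', v', rfl⟩ _
  -- The default threshold `0` costs nothing: each index of the union carries a bound from `s` or
  -- `s'`, which already forces `x i > 0`.
  refine ⟨s ∪ s', fun i => max (if i ∈ s then v i else 0) (if i ∈ s' then v' i else 0), ?_⟩
  ext x
  simp only [Set.mem_inter_iff, Set.mem_ofPred_eq, Finset.mem_union, ENNReal.coe_max, max_lt_iff]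
  constructor
  · rintro ⟨h, h'⟩ i hi
    have h0 : 0 < x i := by
      rcases hi with hi | hi
      · exact zero_le.trans_lt (h i hi)
      · exact zero_le.trans_lt (h' i hi)
    constructor
    · split_ifs with hs
      · exact h i hs
      · simpa using h0
    · split_ifs with hs
      · exact h' i hs
      · simpa using h0
  · intro h
    refine ⟨fun i hi => ?_, fun i hi => ?_⟩
    · simpa [hi] using (h i (Or.inl hi)).1
    · simpa [hi] using (h i (Or.inr hi)).2

lemma unitExp_survival (s : Finset ℕ) (v : ℕ → ℝ≥0) (l : ℝ≥0) :
    unitExp {x | ∀ i ∈ s, (v i : ℝ≥0∞) < poissonTimes l i x} =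
      ENNReal.ofReal (∏ i ∈ s, Real.exp (-((l : ℝ) * (v i : ℝ)))) := by
  have : {x | ∀ i ∈ s, (v i : ℝ≥0∞) < poissonTimes l i x}
      = Set.pi s fun i => Set.Ioi ((l : ℝ) * v i) := by
    ext x; simp [lt_poissonTimes_iff]
  rw [this, unitExp, Measure.infinitePi_pi _ (fun i _ => measurableSet_Ioi),
    ENNReal.ofReal_prod_of_nonneg fun i _ => (Real.exp_pos _).le]
  exact Finset.prod_congr rfl fun i _ => expMeasure_one_Ioi (by positivity)

lemma IsMixedPoisson.ae_pos {Ω : Type*} [MeasurableSpace Ω] {P : Measure Ω} [IsProbabilityMeasure P]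
    {L : Measure ℝ≥0} [IsProbabilityMeasure L] {V : ℕ → Ω → ℝ≥0∞} (hV : IsMixedPoisson P L V) :
    ∀ᵐ ω ∂P, ∀ i, 0 < V i ω := by
  rw [ae_all_iff]
  intro i
  have h := hV.survival (i + 1) 0
  simp only [Pi.zero_apply, ENNReal.coe_zero, NNReal.coe_zero, mul_zero, neg_zero, Real.exp_zero,
    Finset.prod_const_one, ENNReal.ofReal_one, lintegral_one, measure_univ] at h
  have hm : MeasurableSet {ω | ∀ j < i + 1, 0 < V j ω} := by
    have : {ω | ∀ j < i + 1, 0 < V j ω} = ⋂ j, ⋂ _ : j < i + 1, {ω | 0 < V j ω} := by ext; simp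
    rw [this]
    exact MeasurableSet.iInter fun j => MeasurableSet.iInter fun _ =>
      measurableSet_lt measurable_const (hV.measurable j)
  filter_upwards [(mem_ae_iff_prob_eq_one hm).2 h] with ω hω
  exact hω i (Nat.lt_succ_self i)

lemma IsMixedPoisson.map_eq {Ω : Type*} [MeasurableSpace Ω] {P : Measure Ω} [IsProbabilityMeasure P]
    {L : Measure ℝ≥0} [IsProbabilityMeasure L] {V : ℕ → Ω → ℝ≥0∞} (hV : IsMixedPoisson P L V) :
    P.map (fun ω i => V i ω) = (L.prod unitExp).map fun p i => poissonTimes p.1 i p.2 := by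
  have hVm : Measurable fun ω i => V i ω := measurable_pi_lambda _ hV.measurable
  have := Measure.isProbabilityMeasure_map (μ := P) hVm.aemeasurable
  have := Measure.isProbabilityMeasure_map (μ := L.prod unitExp) measurable_poissonTimes.aemeasurable
  refine ext_of_generate_finite _ generateFrom_survival isPiSystem_survival ?_ (by simp)
  rintro _ ⟨s, v, rfl⟩
  have hm : MeasurableSet {x : ℕ → ℝ≥0∞ | ∀ i ∈ s, (v i : ℝ≥0∞) < x i} := by
    rw [generateFrom_survival]
    exact MeasurableSpace.measurableSet_generateFrom ⟨s, v, rfl⟩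
  rw [Measure.map_apply hVm hm, Measure.map_apply measurable_poissonTimes hm,
    Measure.prod_apply (measurable_poissonTimes hm)]
  obtain ⟨n, hn⟩ := s.exists_nat_subset_range
  -- The survival function is given only for initial segments. Thresholds `0` off `s` change the
  -- event by a null set, as all times are almost surely positive.
  have h := hV.survival n fun i => if i ∈ s then v i else 0
  have h1 : P ((fun ω i => V i ω) ⁻¹' {x : ℕ → ℝ≥0∞ | ∀ i ∈ s, (v i : ℝ≥0∞) < x i}) =
      P {ω | ∀ i < n, (((if i ∈ s then v i else 0 : ℝ≥0)) : ℝ≥0∞) < V i ω} := by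
    refine measure_congr ?_
    filter_upwards [hV.ae_pos] with ω hω
    refine propext ⟨fun h i _ => ?_, fun h i hi => ?_⟩
    · split_ifs with hs
      · exact h i hs
      · simpa using hω i
    · simpa [hi] using h i (Finset.mem_range.1 (hn hi))
  rw [h1, h]
  refine lintegral_congr fun l => ?_
  refine Eq.trans ?_ (unitExp_survival s v l).symm
  congr 1
  rw [← Finset.prod_subset hn (fun i _ hi => by simp [hi])]
  exact Finset.prod_congr rfl fun i hi => by simp [hi]

lemma IsMixedPoisson.lintegral_eq {Ω : Type*} [MeasurableSpace Ω] {P : Measure Ω}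
    [IsProbabilityMeasure P] {L : Measure ℝ≥0} [IsProbabilityMeasure L] {V : ℕ → Ω → ℝ≥0∞}
    (hV : IsMixedPoisson P L V) {F : (ℕ → ℝ≥0∞) → ℝ≥0∞} (hF : Measurable F) :
    ∫⁻ ω, F (fun i => V i ω) ∂P = ∫⁻ l, ∫⁻ x, F (fun i => poissonTimes l i x) ∂unitExp ∂L := by
  rw [← lintegral_map hF (measurable_pi_lambda _ hV.measurable), hV.map_eq,
    lintegral_map hF measurable_poissonTimes]
  exact lintegral_prod _ (hF.comp measurable_poissonTimes).aemeasurable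

/-! ### Weights of single claims and of pairs, and their disintegration over the rate -/

/-- The expectation of a function of the `i`-th inter-claim time on the event that the claim
arrives up to time `t`. -/
noncomputable def singleWeight {Ω : Type*} [MeasurableSpace Ω] (P : Measure Ω) (V : ℕ → Ω → ℝ≥0∞)
    (t : ℝ) (g : ℝ≥0∞ → ℝ≥0∞) (i : ℕ) : ℝ≥0∞ :=
  ∫⁻ ω in {ω | arrivalTime V (i + 1) ω ≤ ENNReal.ofReal t}, g (V i ω) ∂P

/-- The expectation of a product of functions of two distinct inter-claim times on the event that
both claims arrive up to time `t`. -/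
noncomputable def pairWeight {Ω : Type*} [MeasurableSpace Ω] (P : Measure Ω) (V : ℕ → Ω → ℝ≥0∞)
    (t : ℝ) (g h : ℝ≥0∞ → ℝ≥0∞) (z : ℕ × ℕ) : ℝ≥0∞ :=
  if z.1 = z.2 then 0 else
    ∫⁻ ω in {ω | arrivalTime V (max z.1 z.2 + 1) ω ≤ ENNReal.ofReal t},
      g (V z.1 ω) * h (V z.2 ω) ∂P

lemma measurable_arrivalTime {Ω : Type*} [MeasurableSpace Ω] {V : ℕ → Ω → ℝ≥0∞}
    (hV : ∀ i, Measurable (V i)) (n : ℕ) : Measurable (arrivalTime V n) := by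
  unfold arrivalTime
  fun_prop

lemma measurableSet_arrivalTime_le {Ω : Type*} [MeasurableSpace Ω] {V : ℕ → Ω → ℝ≥0∞}
    (hV : ∀ i, Measurable (V i)) (n : ℕ) (a : ℝ≥0∞) : MeasurableSet {ω | arrivalTime V n ω ≤ a} :=
  measurableSet_le (measurable_arrivalTime hV n) measurable_const

lemma measurable_poissonTimes_right (l : ℝ≥0) (i : ℕ) : Measurable (poissonTimes l i) := by
  unfold poissonTimes; fun_prop

/-- The arrival-time event as an indicator on sequences of inter-claim times. -/
noncomputable def arrivalIndicator (t : ℝ) (n : ℕ) (y : ℕ → ℝ≥0∞) : ℝ≥0∞ :=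
  if ∑ i ∈ Finset.range n, y i ≤ ENNReal.ofReal t then 1 else 0

lemma measurable_arrivalIndicator (t : ℝ) (n : ℕ) : Measurable (arrivalIndicator t n) := by
  unfold arrivalIndicator
  exact Measurable.ite (measurableSet_le (by fun_prop) measurable_const) measurable_const
    measurable_const

lemma setLIntegral_arrivalTime_le {Ω : Type*} [MeasurableSpace Ω] {P : Measure Ω}
    {V : ℕ → Ω → ℝ≥0∞} (hV : ∀ i, Measurable (V i)) (t : ℝ) (n : ℕ) (f : Ω → ℝ≥0∞) :
    ∫⁻ ω in {ω | arrivalTime V n ω ≤ ENNReal.ofReal t}, f ω ∂P =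
      ∫⁻ ω, f ω * arrivalIndicator t n (fun i => V i ω) ∂P := by
  rw [← lintegral_indicator (measurableSet_arrivalTime_le hV n _)]
  refine lintegral_congr fun ω => ?_
  by_cases h : arrivalTime V n ω ≤ ENNReal.ofReal t
  · have h' : ∑ i ∈ Finset.range n, V i ω ≤ ENNReal.ofReal t := h
    simp [Set.indicator, h, arrivalIndicator, h']
  · have h' : ¬ ∑ i ∈ Finset.range n, V i ω ≤ ENNReal.ofReal t := h
    simp [Set.indicator, h, arrivalIndicator, h']

section
variable {Ω : Type*} [MeasurableSpace Ω] {P : Measure Ω}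
    [IsProbabilityMeasure P] {L : Measure ℝ≥0} [IsProbabilityMeasure L] {V : ℕ → Ω → ℝ≥0∞}

lemma IsMixedPoisson.tsum_singleWeight (hV : IsMixedPoisson P L V) (t : ℝ) {g : ℝ≥0∞ → ℝ≥0∞}
    (hg : Measurable g) :
    ∑' i, singleWeight P V t g i = ∫⁻ l, ∑' i, singleWeight unitExp (poissonTimes l) t g i ∂L := by
  unfold singleWeight
  simp_rw [setLIntegral_arrivalTime_le hV.measurable,
    setLIntegral_arrivalTime_le (measurable_poissonTimes_right _)]
  have hF : ∀ i, Measurable fun y : ℕ → ℝ≥0∞ => g (y i) * arrivalIndicator t (i + 1) y :=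
    fun i => (hg.comp (measurable_pi_apply i)).mul (measurable_arrivalIndicator t _)
  rw [lintegral_tsum]
  · exact tsum_congr fun i => hV.lintegral_eq (hF i)
  · exact fun i => (Measurable.lintegral_prod_right'
      ((hF i).comp measurable_poissonTimes)).aemeasurable

lemma IsMixedPoisson.tsum_pairWeight (hV : IsMixedPoisson P L V) (t : ℝ) {g h : ℝ≥0∞ → ℝ≥0∞}
    (hg : Measurable g) (hh : Measurable h) :
    ∑' z, pairWeight P V t g h z =
      ∫⁻ l, ∑' z, pairWeight unitExp (poissonTimes l) t g h z ∂L := by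
  unfold pairWeight
  simp_rw [setLIntegral_arrivalTime_le hV.measurable,
    setLIntegral_arrivalTime_le (measurable_poissonTimes_right _)]
  have hF : ∀ z : ℕ × ℕ, Measurable fun y : ℕ → ℝ≥0∞ =>
      g (y z.1) * h (y z.2) * arrivalIndicator t (max z.1 z.2 + 1) y :=
    fun z => ((hg.comp (measurable_pi_apply _)).mul (hh.comp (measurable_pi_apply _))).mul
      (measurable_arrivalIndicator t _)
  rw [lintegral_tsum]
  · refine tsum_congr fun z => ?_
    split_ifs
    · simp
    · exact hV.lintegral_eq (hF z)
  · intro z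
    split_ifs
    · exact aemeasurable_const
    · exact (Measurable.lintegral_prod_right' ((hF z).comp measurable_poissonTimes)).aemeasurable

end

/-! ### The mixture weights, and their sums at a fixed rate -/

/-- The weight `exp (-β v)` of the distribution `H_s`. -/
noncomputable def discount (β : ℝ) (v : ℝ≥0∞) : ℝ≥0∞ := expWeight β v.toReal

/-- The weight `1 - exp (-β v)` of the distribution `H_ℓ`. -/
noncomputable def loading (β : ℝ) (v : ℝ≥0∞) : ℝ≥0∞ :=
  ENNReal.ofReal (1 - Real.exp (-(β * v.toReal)))

@[fun_prop]
lemma measurable_discount (β : ℝ) : Measurable (discount β) :=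
  (measurable_expWeight β).comp ENNReal.measurable_toReal

@[fun_prop]
lemma measurable_loading (β : ℝ) : Measurable (loading β) := by
  unfold loading
  exact (measurable_const.sub (by fun_prop : Measurable fun v : ℝ≥0∞ =>
    Real.exp (-(β * v.toReal)))).ennreal_ofReal

lemma exp_neg_mul_toReal_le_one {β : ℝ} (hβ : 0 ≤ β) (v : ℝ≥0∞) :
    Real.exp (-(β * v.toReal)) ≤ 1 := by
  rw [Real.exp_le_one_iff]
  have : 0 ≤ β * v.toReal := by positivity
  linarith

/-- The constant `1` is written `discount 0 v` so that sums with weight `1` are instances of the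
discount formulas. -/
lemma loading_add_discount {β : ℝ} (hβ : 0 ≤ β) (v : ℝ≥0∞) :
    loading β v + discount β v = discount 0 v := by
  unfold loading discount expWeight
  rw [← ENNReal.ofReal_add (sub_nonneg.2 (exp_neg_mul_toReal_le_one hβ v)) (Real.exp_pos _).le]
  simp

lemma discount_zero (v : ℝ≥0∞) : discount 0 v = 1 := by simp [discount, expWeight]

lemma ae_unitExp_pos : ∀ᵐ x ∂unitExp, ∀ i, 0 < x i := by
  rw [ae_all_iff]
  intro i
  have h : ∀ᵐ a ∂(expMeasure 1), 0 < a := by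
    have h2 := expMeasure_one_Ioi (le_refl (0 : ℝ))
    rw [neg_zero, Real.exp_zero, ENNReal.ofReal_one] at h2
    exact (mem_ae_iff_prob_eq_one measurableSet_Ioi).2 h2
  rw [← map_eval_unitExp i] at h
  exact ae_of_ae_map (measurable_pi_apply i).aemeasurable h

lemma discount_poissonTimes {β : ℝ} {l : ℝ≥0} {i : ℕ} {x : ℕ → ℝ} (hx : 0 < x i) :
    discount β (poissonTimes l i x) = expWeight (β / l) (x i) := by
  unfold discount poissonTimes expWeight
  rw [ENNReal.toReal_div, ENNReal.toReal_ofReal hx.le, ENNReal.coe_toReal]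
  congr 3
  ring

lemma arrivalIndicator_poissonTimes {l : ℝ≥0} (hl : l ≠ 0) {t : ℝ} (ht : 0 ≤ t) {x : ℕ → ℝ}
    (hx : ∀ i, 0 < x i) (n : ℕ) :
    arrivalIndicator t n (fun i => poissonTimes l i x) =
      stepLE (l * t) (∑ i ∈ Finset.range n, x i) := by
  unfold arrivalIndicator stepLE poissonTimes
  have h : ∑ i ∈ Finset.range n, ENNReal.ofReal (x i) / l
      = ENNReal.ofReal (∑ i ∈ Finset.range n, x i) / l := by
    rw [ENNReal.ofReal_sum_of_nonneg fun i _ => (hx i).le]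
    simp_rw [div_eq_mul_inv, Finset.sum_mul]
  refine if_congr ?_ rfl rfl
  rw [h, ENNReal.div_le_iff_le_mul (by simp [hl]) (by simp), ← ENNReal.ofReal_coe_nnreal (p := l),
    ← ENNReal.ofReal_mul ht, ENNReal.ofReal_le_ofReal_iff (by positivity), mul_comm]

lemma arrivalIndicator_poissonTimes_zero (t : ℝ) {x : ℕ → ℝ} (hx : ∀ i, 0 < x i) (n : ℕ) :
    arrivalIndicator t (n + 1) (fun i => poissonTimes 0 i x) = 0 := by
  unfold arrivalIndicator
  rw [if_neg]
  have h : poissonTimes 0 0 x = ∞ := by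
    unfold poissonTimes
    rw [ENNReal.coe_zero, ENNReal.div_zero (by simpa using hx 0)]
  rw [Finset.sum_range_succ', h]
  simp

lemma singleWeight_poissonTimes_zero (t : ℝ) (g : ℝ≥0∞ → ℝ≥0∞) (i : ℕ) :
    singleWeight unitExp (poissonTimes 0) t g i = 0 := by
  unfold singleWeight
  rw [setLIntegral_arrivalTime_le (measurable_poissonTimes_right _), lintegral_eq_zero_of_ae_eq_zero]
  filter_upwards [ae_unitExp_pos] with x hx
  rw [arrivalIndicator_poissonTimes_zero t hx, mul_zero, Pi.zero_apply]

lemma pairWeight_poissonTimes_zero (t : ℝ) (g h : ℝ≥0∞ → ℝ≥0∞) (z : ℕ × ℕ) :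
    pairWeight unitExp (poissonTimes 0) t g h z = 0 := by
  unfold pairWeight
  split_ifs
  · rfl
  rw [setLIntegral_arrivalTime_le (measurable_poissonTimes_right _), lintegral_eq_zero_of_ae_eq_zero]
  filter_upwards [ae_unitExp_pos] with x hx
  rw [arrivalIndicator_poissonTimes_zero t hx, mul_zero, Pi.zero_apply]

lemma frakA_zero (t β : ℝ) : frakA t 0 β = 0 := by simp [frakA]

lemma frakBdiag_zero (t β : ℝ) : frakBdiag t 0 β = 0 := by simp [frakBdiag]

lemma frakBmixed_zero (t β : ℝ) : frakBmixed t 0 β = 0 := by simp [frakBmixed]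

variable {β t : ℝ}

lemma frakA_nonneg (hβ : 0 ≤ β) (ht : 0 ≤ t) (l : ℝ≥0) : 0 ≤ frakA t l β := by
  rcases eq_or_ne l 0 with rfl | hl
  · simp [frakA_zero]
  · have hl' : (0 : ℝ) < l := by positivity
    rw [← frakA_scale hl' hβ]
    exact frakA_one_nonneg (by positivity) (by positivity)

lemma frakBmixed_nonneg (hβ : 0 ≤ β) (ht : 0 ≤ t) (l : ℝ≥0) : 0 ≤ frakBmixed t l β := by
  rcases eq_or_ne l 0 with rfl | hl
  · simp [frakBmixed_zero]
  · have hl' : (0 : ℝ) < l := by positivity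
    rw [← frakBmixed_scale hl' hβ]
    exact frakBmixed_one_nonneg (by positivity) (by positivity)

lemma frakBdiag_nonneg (hβ : 0 ≤ β) (ht : 0 ≤ t) (l : ℝ≥0) : 0 ≤ frakBdiag t l β := by
  rcases eq_or_ne l 0 with rfl | hl
  · simp [frakBdiag_zero]
  · have hl' : (0 : ℝ) < l := by positivity
    rw [← frakBdiag_scale hl' hβ]
    exact frakBdiag_one_nonneg (by positivity) (by positivity)

lemma tsum_singleWeight_discount (hβ : 0 ≤ β) (ht : 0 ≤ t) (l : ℝ≥0) :
    ∑' i, singleWeight unitExp (poissonTimes l) t (discount β) i =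
      ENNReal.ofReal (frakA t l β) := by
  rcases eq_or_ne l 0 with rfl | hl
  · simp [singleWeight_poissonTimes_zero, frakA_zero]
  have hl' : (0 : ℝ) < l := by positivity
  rw [← frakA_scale hl' hβ, ← tsum_unitExp_expWeight (by positivity) (by positivity)]
  refine tsum_congr fun i => ?_
  unfold singleWeight
  rw [setLIntegral_arrivalTime_le (measurable_poissonTimes_right _)]
  refine lintegral_congr_ae ?_
  filter_upwards [ae_unitExp_pos] with x hx
  rw [arrivalIndicator_poissonTimes hl ht hx, discount_poissonTimes (hx i)]

lemma tsum_pairWeight_discount {β' : ℝ} (hβ' : 0 ≤ β') (ht : 0 ≤ t) {l : ℝ≥0}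
    (hl : l ≠ 0) :
    ∑' z, pairWeight unitExp (poissonTimes l) t (discount β) (discount β') z =
      ENNReal.ofReal (∫ x in (0 : ℝ)..(l * t),
        Real.exp (-x) * Real.exp (-(β / l * x)) * innerPair (β' / l + 1) (l * t - x)) := by
  rw [← tsum_unitExp_expWeight_pair (by positivity) (by positivity)]
  refine tsum_congr fun z => ?_
  unfold pairWeight
  refine if_congr Iff.rfl rfl ?_
  rw [setLIntegral_arrivalTime_le (measurable_poissonTimes_right _)]
  refine lintegral_congr_ae ?_
  filter_upwards [ae_unitExp_pos] with x hx
  rw [arrivalIndicator_poissonTimes hl ht hx, discount_poissonTimes (hx _),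
    discount_poissonTimes (hx _)]

lemma tsum_pairWeight_discount_discount (hβ : 0 ≤ β) (ht : 0 ≤ t) (l : ℝ≥0) :
    ∑' z, pairWeight unitExp (poissonTimes l) t (discount β) (discount β) z =
      ENNReal.ofReal (frakBdiag t l β) := by
  rcases eq_or_ne l 0 with rfl | hl
  · simp [pairWeight_poissonTimes_zero, frakBdiag_zero]
  have hl' : (0 : ℝ) < l := by positivity
  rw [tsum_pairWeight_discount hβ ht hl, integral_frakBdiag (by positivity), frakBdiag_scale hl' hβ]

lemma tsum_pairWeight_discount_zero (hβ : 0 ≤ β) (ht : 0 ≤ t) (l : ℝ≥0) :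
    ∑' z, pairWeight unitExp (poissonTimes l) t (discount β) (discount 0) z =
      ENNReal.ofReal (frakBmixed t l β) := by
  rcases eq_or_ne l 0 with rfl | hl
  · simp [pairWeight_poissonTimes_zero, frakBmixed_zero]
  have hl' : (0 : ℝ) < l := by positivity
  rw [tsum_pairWeight_discount le_rfl ht hl, zero_div, zero_add,
    integral_frakBmixed (by positivity), frakBmixed_scale hl' hβ]

section
variable {Ω : Type*} [MeasurableSpace Ω] {P : Measure Ω} {V : ℕ → Ω → ℝ≥0∞}

lemma singleWeight_loading_add (hV : ∀ i, Measurable (V i)) (hβ : 0 ≤ β) (i : ℕ) :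
    singleWeight P V t (loading β) i + singleWeight P V t (discount β) i =
      singleWeight P V t (discount 0) i := by
  unfold singleWeight
  refine (lintegral_add_left ((measurable_loading β).comp (hV i)) _).symm.trans ?_
  simp_rw [Function.comp_apply, loading_add_discount hβ]

lemma pairWeight_comm (g h : ℝ≥0∞ → ℝ≥0∞) (z : ℕ × ℕ) :
    pairWeight P V t g h z.swap = pairWeight P V t h g z := by
  unfold pairWeight
  simp only [Prod.fst_swap, Prod.snd_swap, eq_comm (a := z.2), max_comm z.2,
    mul_comm (g (V z.2 _))]

lemma tsum_pairWeight_comm (g h : ℝ≥0∞ → ℝ≥0∞) :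
    ∑' z, pairWeight P V t g h z = ∑' z, pairWeight P V t h g z := by
  rw [← (Equiv.prodComm ℕ ℕ).tsum_eq]
  exact tsum_congr fun z => pairWeight_comm g h z

lemma pairWeight_add_right (hV : ∀ i, Measurable (V i)) {g h k : ℝ≥0∞ → ℝ≥0∞}
    (hg : Measurable g) (hh : Measurable h) (z : ℕ × ℕ) :
    pairWeight P V t g h z + pairWeight P V t g k z =
      pairWeight P V t g (fun v => h v + k v) z := by
  unfold pairWeight
  split_ifs
  · simp
  · refine (lintegral_add_left ((hg.comp (hV _)).mul (hh.comp (hV _))) _).symm.trans ?_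
    simp_rw [Pi.mul_apply, Function.comp_apply, mul_add]

lemma pairWeight_loading_add (hV : ∀ i, Measurable (V i)) (hβ : 0 ≤ β) {g : ℝ≥0∞ → ℝ≥0∞}
    (hg : Measurable g) (z : ℕ × ℕ) :
    pairWeight P V t g (loading β) z + pairWeight P V t g (discount β) z =
      pairWeight P V t g (discount 0) z := by
  rw [pairWeight_add_right hV hg (measurable_loading β)]
  simp_rw [loading_add_discount hβ]

end

/-- The subtraction device for the loading weights: a decomposition in `[0, ∞]` yields at once the
value of the unknown part and the nonnegativity of the real difference. -/
lemma eq_ofReal_sub_of_add_eq {X : ℝ≥0∞} {a b : ℝ} (ha : 0 ≤ a) (hb : 0 ≤ b)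
    (h : X + ENNReal.ofReal b = ENNReal.ofReal a) : 0 ≤ a - b ∧ X = ENNReal.ofReal (a - b) := by
  have hle : ENNReal.ofReal b ≤ ENNReal.ofReal a := h ▸ le_add_self
  refine ⟨sub_nonneg.2 ((ENNReal.ofReal_le_ofReal_iff ha).1 hle), ?_⟩
  rw [ENNReal.ofReal_sub _ hb, ← h, ENNReal.add_sub_cancel_right ENNReal.ofReal_ne_top]

lemma nonneg_and_tsum_singleWeight_loading (hβ : 0 ≤ β) (ht : 0 ≤ t) (l : ℝ≥0) :
    0 ≤ (l : ℝ) * t - frakA t l β ∧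
      ∑' i, singleWeight unitExp (poissonTimes l) t (loading β) i =
        ENNReal.ofReal (l * t - frakA t l β) := by
  refine eq_ofReal_sub_of_add_eq (by positivity) (frakA_nonneg hβ ht l) ?_
  rw [← tsum_singleWeight_discount hβ ht, ← frakA_zero_right t l,
    ← tsum_singleWeight_discount le_rfl ht, ← ENNReal.tsum_add]
  exact tsum_congr fun i => singleWeight_loading_add (measurable_poissonTimes_right l) hβ i

lemma nonneg_and_tsum_pairWeight_discount_loading (hβ : 0 ≤ β) (ht : 0 ≤ t) (l : ℝ≥0) :
    0 ≤ coeffLS t l β ∧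
      ∑' z, pairWeight unitExp (poissonTimes l) t (discount β) (loading β) z =
        ENNReal.ofReal (coeffLS t l β) := by
  refine eq_ofReal_sub_of_add_eq (frakBmixed_nonneg hβ ht l) (frakBdiag_nonneg hβ ht l) ?_
  rw [← tsum_pairWeight_discount_discount hβ ht, ← tsum_pairWeight_discount_zero hβ ht,
    ← ENNReal.tsum_add]
  exact tsum_congr fun z =>
    pairWeight_loading_add (measurable_poissonTimes_right l) hβ (measurable_discount β) z

lemma nonneg_and_tsum_pairWeight_loading_zero (hβ : 0 ≤ β) (ht : 0 ≤ t) (l : ℝ≥0) :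
    0 ≤ frakBzero t l - frakBmixed t l β ∧
      ∑' z, pairWeight unitExp (poissonTimes l) t (loading β) (discount 0) z =
        ENNReal.ofReal (frakBzero t l - frakBmixed t l β) := by
  refine eq_ofReal_sub_of_add_eq (by unfold frakBzero; positivity) (frakBmixed_nonneg hβ ht l) ?_
  rw [tsum_pairWeight_comm, ← tsum_pairWeight_discount_zero hβ ht, tsum_pairWeight_comm (discount β),
    ← frakBdiag_zero_right t l, ← tsum_pairWeight_discount_discount le_rfl ht, ← ENNReal.tsum_add]
  exact tsum_congr fun z =>
    pairWeight_loading_add (measurable_poissonTimes_right l) hβ (measurable_discount 0) z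

/-- Subtraction in both slots: with `q = 1 - p` for each weight, `q q' = (q - q p')`, where `q = 1 -
p` was itself obtained by subtraction. -/
lemma nonneg_and_tsum_pairWeight_loading_loading (hβ : 0 ≤ β) (ht : 0 ≤ t) (l : ℝ≥0) :
    0 ≤ coeffLL t l β ∧
      ∑' z, pairWeight unitExp (poissonTimes l) t (loading β) (loading β) z =
        ENNReal.ofReal (coeffLL t l β) := by
  obtain ⟨h1, h2⟩ := nonneg_and_tsum_pairWeight_discount_loading hβ ht l
  obtain ⟨h3, h4⟩ := nonneg_and_tsum_pairWeight_loading_zero hβ ht l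
  have e : coeffLL t l β = (frakBzero t l - frakBmixed t l β) - coeffLS t l β := by
    unfold coeffLL coeffLS; ring
  rw [e]
  refine eq_ofReal_sub_of_add_eq h3 h1 ?_
  rw [← h2, ← h4, tsum_pairWeight_comm (discount β), ← ENNReal.tsum_add]
  exact tsum_congr fun z =>
    pairWeight_loading_add (measurable_poissonTimes_right l) hβ (measurable_loading β) z

/-! ### Sums of the weights for the mixed process, and finiteness of the claim count -/

section
variable {Ω : Type*} [MeasurableSpace Ω] {P : Measure Ω}
    [IsProbabilityMeasure P] {L : Measure ℝ≥0} [IsProbabilityMeasure L] {V : ℕ → Ω → ℝ≥0∞}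

namespace IsMixedPoisson

lemma tsum_singleWeight_discount (hV : IsMixedPoisson P L V) (hβ : 0 ≤ β) (ht : 0 ≤ t) :
    ∑' i, singleWeight P V t (discount β) i = ∫⁻ l : ℝ≥0, ENNReal.ofReal (frakA t l β) ∂L := by
  rw [hV.tsum_singleWeight t (measurable_discount β)]
  simp_rw [AggregateClaims.tsum_singleWeight_discount hβ ht]

lemma tsum_singleWeight_loading (hV : IsMixedPoisson P L V) (hβ : 0 ≤ β) (ht : 0 ≤ t) :
    ∑' i, singleWeight P V t (loading β) i =
      ∫⁻ l : ℝ≥0, ENNReal.ofReal (l * t - frakA t l β) ∂L := by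
  rw [hV.tsum_singleWeight t (measurable_loading β)]
  simp_rw [fun l => (nonneg_and_tsum_singleWeight_loading hβ ht l).2]

lemma tsum_pairWeight_discount_discount (hV : IsMixedPoisson P L V) (hβ : 0 ≤ β) (ht : 0 ≤ t) :
    ∑' z, pairWeight P V t (discount β) (discount β) z =
      ∫⁻ l : ℝ≥0, ENNReal.ofReal (frakBdiag t l β) ∂L := by
  rw [hV.tsum_pairWeight t (measurable_discount β) (measurable_discount β)]
  simp_rw [AggregateClaims.tsum_pairWeight_discount_discount hβ ht]

lemma tsum_pairWeight_discount_loading (hV : IsMixedPoisson P L V) (hβ : 0 ≤ β) (ht : 0 ≤ t) :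
    ∑' z, pairWeight P V t (discount β) (loading β) z =
      ∫⁻ l : ℝ≥0, ENNReal.ofReal (coeffLS t l β) ∂L := by
  rw [hV.tsum_pairWeight t (measurable_discount β) (measurable_loading β)]
  simp_rw [fun l => (nonneg_and_tsum_pairWeight_discount_loading hβ ht l).2]

lemma tsum_pairWeight_loading_loading (hV : IsMixedPoisson P L V) (hβ : 0 ≤ β) (ht : 0 ≤ t) :
    ∑' z, pairWeight P V t (loading β) (loading β) z =
      ∫⁻ l : ℝ≥0, ENNReal.ofReal (coeffLL t l β) ∂L := by
  rw [hV.tsum_pairWeight t (measurable_loading β) (measurable_loading β)]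
  simp_rw [fun l => (nonneg_and_tsum_pairWeight_loading_loading hβ ht l).2]

/-- Almost surely, only finitely many claims arrive up to time `t`. -/
lemma ae_finite (hV : IsMixedPoisson P L V) (ht : 0 ≤ t) :
    ∀ᵐ ω ∂P, {i | arrivalTime V (i + 1) ω ≤ ENNReal.ofReal t}.Finite := by
  set G : (ℕ → ℝ≥0∞) → ℝ≥0∞ := fun y => ∑' i, arrivalIndicator t (i + 1) y with hG
  have hGm : Measurable G := Measurable.tsum fun i => measurable_arrivalIndicator t (i + 1)
  have hS : MeasurableSet {y | G y = ∞} := hGm (measurableSet_singleton ∞)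
  have h := hV.lintegral_eq (F := Set.indicator {y | G y = ∞} 1) (measurable_one.indicator hS)
  -- The argument is made at each fixed rate, where the expected count is `l t`; after mixing, the
  -- expected count may be infinite.
  have h0 : ∀ l, ∫⁻ x, Set.indicator {y | G y = ∞} 1 (fun i => poissonTimes l i x) ∂unitExp
      = 0 := by
    intro l
    have hfin : ∫⁻ x, G (fun i => poissonTimes l i x) ∂unitExp ≠ ∞ := by
      have h1 := AggregateClaims.tsum_singleWeight_discount (β := 0) le_rfl ht l
      unfold singleWeight at h1
      simp_rw [setLIntegral_arrivalTime_le (measurable_poissonTimes_right _), discount_zero,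
        one_mul] at h1
      have hm : Measurable fun x => fun i => poissonTimes l i x :=
        measurable_pi_lambda _ (measurable_poissonTimes_right l)
      have h2 : ∫⁻ x, G (fun i => poissonTimes l i x) ∂unitExp
          = ∑' i, ∫⁻ x, arrivalIndicator t (i + 1) (fun i => poissonTimes l i x) ∂unitExp :=
        lintegral_tsum fun i => ((measurable_arrivalIndicator t _).comp hm).aemeasurable
      rw [h2, h1]
      exact ENNReal.ofReal_ne_top
    have hm : Measurable fun x => G fun i => poissonTimes l i x :=
        hGm.comp (measurable_pi_lambda _ (measurable_poissonTimes_right l))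
    rw [lintegral_eq_zero_of_ae_eq_zero]
    filter_upwards [ae_lt_top hm hfin] with x hx
    simp [hx.ne]
  simp_rw [h0, lintegral_zero] at h
  have hVm : Measurable fun ω i => V i ω := measurable_pi_lambda _ hV.measurable
  have h2 := (lintegral_eq_zero_iff ((measurable_one.indicator hS).comp hVm)).1 h
  filter_upwards [h2] with ω hω
  have hlt : G (fun i => V i ω) ≠ ∞ := by
    intro hc
    simp [Set.indicator, hc] at hω
  have h1 := ENNReal.finite_const_le_of_tsum_ne_top hlt one_ne_zero
  refine h1.subset fun i hi => ?_
  have hi' : ∑ j ∈ Finset.range (i + 1), V j ω ≤ ENNReal.ofReal t := hi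
  simp [arrivalIndicator, hi']

end IsMixedPoisson

end

/-! ### Laws of one and two claim sizes on arrival events -/

/-- Uniqueness from the distribution function on the line, applied to one coordinate at a time with
the other restricted to a fixed set. -/
lemma ext_of_Iic_prod_Iic {μ ν : Measure (ℝ × ℝ)} [IsFiniteMeasure μ] [IsFiniteMeasure ν]
    (h : ∀ y z : ℝ, μ (Set.Iic y ×ˢ Set.Iic z) = ν (Set.Iic y ×ˢ Set.Iic z)) : μ = ν := by
  have h1 : ∀ (y : ℝ) {C : Set ℝ}, MeasurableSet C →
      μ (Set.Iic y ×ˢ C) = ν (Set.Iic y ×ˢ C) := by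
    intro y C hC
    have e : ∀ (κ : Measure (ℝ × ℝ)) {D : Set ℝ}, MeasurableSet D →
        (κ.restrict (Prod.fst ⁻¹' Set.Iic y)).map Prod.snd D = κ (Set.Iic y ×ˢ D) := by
      intro κ D hD
      rw [Measure.map_apply measurable_snd hD, Measure.restrict_apply (measurable_snd hD)]
      congr 1; ext p; simp [and_comm]
    have : (μ.restrict (Prod.fst ⁻¹' Set.Iic y)).map Prod.snd
        = (ν.restrict (Prod.fst ⁻¹' Set.Iic y)).map Prod.snd := by
      refine Measure.ext_of_Iic _ _ fun z => ?_
      rw [e _ measurableSet_Iic, e _ measurableSet_Iic, h]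
    rw [← e μ hC, ← e ν hC, this]
  refine Measure.ext_prod fun {B C} hB hC => ?_
  have e : ∀ (κ : Measure (ℝ × ℝ)) {D : Set ℝ}, MeasurableSet D →
      (κ.restrict (Prod.snd ⁻¹' C)).map Prod.fst D = κ (D ×ˢ C) := by
    intro κ D hD
    rw [Measure.map_apply measurable_fst hD, Measure.restrict_apply (measurable_fst hD)]
    congr 1
  have : (μ.restrict (Prod.snd ⁻¹' C)).map Prod.fst
      = (ν.restrict (Prod.snd ⁻¹' C)).map Prod.fst := by
    refine Measure.ext_of_Iic _ _ fun y => ?_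
    rw [e _ measurableSet_Iic, e _ measurableSet_Iic, h1 y hC]
  rw [← e μ hB, ← e ν hB, this]

lemma measure_inter_eq_lintegral_condExp {Ω : Type*} {m m0 : MeasurableSpace Ω} {P : Measure Ω}
    [IsProbabilityMeasure P] (hm : m ≤ m0) {A B : Set Ω} (hA : MeasurableSet[m] A)
    (hB : MeasurableSet B) : P (B ∩ A) = ∫⁻ ω in A, ENNReal.ofReal ((P⟦B | m⟧) ω) ∂P := by
  have hint : Integrable (B.indicator fun _ => (1 : ℝ)) P :=
    (integrable_const (1 : ℝ)).indicator hB
  rw [← ofReal_integral_eq_lintegral_ofReal integrable_condExp.integrableOn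
    (ae_restrict_of_ae (condExp_nonneg
      (Filter.Eventually.of_forall fun ω => Set.indicator_nonneg (fun _ _ => zero_le_one) ω))),
    setIntegral_condExp hm hint hA, integral_indicator hB]
  simp [Measure.restrict_apply hB, measureReal_def]

section
variable {Ω : Type*} [MeasurableSpace Ω] {P : Measure Ω} [IsProbabilityMeasure P]
  {V : ℕ → Ω → ℝ≥0∞} {X : ℕ → Ω → ℝ} {β : ℝ} {Hl Hs : Measure ℝ}
  [IsProbabilityMeasure Hl] [IsProbabilityMeasure Hs]

lemma arrivalSigma_le (hV : ∀ i, Measurable (V i)) : arrivalSigma V ≤ ‹MeasurableSpace Ω› :=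
  (measurable_pi_lambda _ hV).comap_le

lemma measurableSet_arrivalSigma_le {Ω : Type*} {V : ℕ → Ω → ℝ≥0∞} (n : ℕ) (a : ℝ≥0∞) :
    MeasurableSet[arrivalSigma V] {ω | arrivalTime V n ω ≤ a} :=
  ⟨{y | ∑ i ∈ Finset.range n, y i ≤ a}, measurableSet_le (by fun_prop) measurable_const, rfl⟩

lemma loading_le_one (β : ℝ) (v : ℝ≥0∞) : loading β v ≤ 1 :=
  ENNReal.ofReal_le_one.2 (by linarith [Real.exp_pos (-(β * v.toReal))])

lemma discount_le_one (hβ : 0 ≤ β) (v : ℝ≥0∞) : discount β v ≤ 1 :=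
  ENNReal.ofReal_le_one.2 (exp_neg_mul_toReal_le_one hβ v)

lemma setLIntegral_ne_top_of_le_one {f : Ω → ℝ≥0∞} (hf : ∀ ω, f ω ≤ 1) (A : Set Ω) :
    ∫⁻ ω in A, f ω ∂P ≠ ∞ :=
  ((lintegral_mono hf).trans_lt (by simp)).ne

lemma ofReal_mix (hβ : 0 ≤ β) (v : ℝ≥0∞) (y : ℝ) :
    ENNReal.ofReal ((1 - Real.exp (-(β * v.toReal))) * cdf Hl y
      + Real.exp (-(β * v.toReal)) * cdf Hs y) =
    loading β v * Hl (Set.Iic y) + discount β v * Hs (Set.Iic y) := by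
  have h1 := sub_nonneg.2 (exp_neg_mul_toReal_le_one hβ v)
  rw [ENNReal.ofReal_add (mul_nonneg h1 (cdf_nonneg _ _))
    (mul_nonneg (Real.exp_pos _).le (cdf_nonneg _ _)), ENNReal.ofReal_mul h1,
    ENNReal.ofReal_mul (Real.exp_pos _).le, ofReal_cdf, ofReal_cdf]
  rfl

lemma mix_nonneg {Hl Hs : Measure ℝ} (hβ : 0 ≤ β) (v : ℝ≥0∞) (y : ℝ) :
    0 ≤ (1 - Real.exp (-(β * v.toReal))) * cdf Hl y + Real.exp (-(β * v.toReal)) * cdf Hs y :=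
  add_nonneg (mul_nonneg (sub_nonneg.2 (exp_neg_mul_toReal_le_one hβ v)) (cdf_nonneg _ _))
    (mul_nonneg (Real.exp_pos _).le (cdf_nonneg _ _))

namespace IsBoudreaultModel

/-- The joint law of a claim size with an event of the arrival process. -/
lemma map_restrict (hX : IsBoudreaultModel P V X β Hl Hs) (hV : ∀ i, Measurable (V i))
    (hβ : 0 ≤ β) {A : Set Ω} (hA : MeasurableSet[arrivalSigma V] A) {i : ℕ}
    (hAi : A ⊆ {ω | arrivalTime V (i + 1) ω ≠ ∞}) :
    (P.restrict A).map (X i) =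
      (∫⁻ ω in A, loading β (V i ω) ∂P) • Hl + (∫⁻ ω in A, discount β (V i ω) ∂P) • Hs := by
  have hm := arrivalSigma_le hV
  have hl := setLIntegral_ne_top_of_le_one (P := P) (fun ω => loading_le_one β (V i ω)) A
  have hd := setLIntegral_ne_top_of_le_one (P := P) (fun ω => discount_le_one hβ (V i ω)) A
  -- The conditional cdf is known for each `y` off a null set depending on `y`. Integrating over `A`
  -- first leaves an identity of distribution functions, so no regular conditional law is needed.
  refine Measure.ext_of_Iic _ _ fun y => ?_
  have hB : MeasurableSet {ω | X i ω ≤ y} := measurableSet_le (hX.measurable i) measurable_const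
  have h1 : (P.restrict A).map (X i) (Set.Iic y) = P ({ω | X i ω ≤ y} ∩ A) := by
    rw [Measure.map_apply (hX.measurable i) measurableSet_Iic]
    exact Measure.restrict_apply hB
  rw [h1, measure_inter_eq_lintegral_condExp hm hA hB]
  have h2 := ae_mono (Measure.restrict_mono hAi le_rfl) (hX.condCdf i y)
  have h3 : ∫⁻ ω in A, ENNReal.ofReal ((P⟦{ω | X i ω ≤ y} | arrivalSigma V⟧) ω) ∂P =
      ∫⁻ ω in A, (loading β (V i ω) * Hl (Set.Iic y) + discount β (V i ω) * Hs (Set.Iic y)) ∂P := by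
    refine lintegral_congr_ae ?_
    filter_upwards [h2] with ω hω
    rw [hω, ofReal_mix hβ]
  rw [h3]
  have hlm : Measurable fun ω => loading β (V i ω) := (measurable_loading β).comp (hV i)
  have hdm : Measurable fun ω => discount β (V i ω) := (measurable_discount β).comp (hV i)
  rw [lintegral_add_left (hlm.mul_const _), lintegral_mul_const _ hlm, lintegral_mul_const _ hdm]
  simp

/-- The joint law of two claim sizes with an event of the arrival process. -/
lemma map_restrict_pair (hX : IsBoudreaultModel P V X β Hl Hs) (hV : ∀ i, Measurable (V i))
    (hβ : 0 ≤ β) {A : Set Ω} (hA : MeasurableSet[arrivalSigma V] A) {i j : ℕ} (hij : i ≠ j)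
    (hAi : A ⊆ {ω | arrivalTime V (i + 1) ω ≠ ∞}) (hAj : A ⊆ {ω | arrivalTime V (j + 1) ω ≠ ∞}) :
    (P.restrict A).map (fun ω => (X i ω, X j ω)) =
      (∫⁻ ω in A, loading β (V i ω) * loading β (V j ω) ∂P) • Hl.prod Hl
      + (∫⁻ ω in A, loading β (V i ω) * discount β (V j ω) ∂P) • Hl.prod Hs
      + (∫⁻ ω in A, discount β (V i ω) * loading β (V j ω) ∂P) • Hs.prod Hl
      + (∫⁻ ω in A, discount β (V i ω) * discount β (V j ω) ∂P) • Hs.prod Hs := by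
  have hm := arrivalSigma_le hV
  have hl := fun ω k => loading_le_one β (V k ω)
  have hd := fun ω k => discount_le_one hβ (V k ω)
  have h1 := setLIntegral_ne_top_of_le_one (P := P) (fun ω => mul_le_one' (hl ω i) (hl ω j)) A
  have h2 := setLIntegral_ne_top_of_le_one (P := P) (fun ω => mul_le_one' (hl ω i) (hd ω j)) A
  have h3 := setLIntegral_ne_top_of_le_one (P := P) (fun ω => mul_le_one' (hd ω i) (hl ω j)) A
  have h4 := setLIntegral_ne_top_of_le_one (P := P) (fun ω => mul_le_one' (hd ω i) (hd ω j)) A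
  have f1 := Measure.smul_finite (Hl.prod Hl) h1
  have f2 := Measure.smul_finite (Hl.prod Hs) h2
  have f3 := Measure.smul_finite (Hs.prod Hl) h3
  have f4 := Measure.smul_finite (Hs.prod Hs) h4
  refine ext_of_Iic_prod_Iic fun y z => ?_
  set B : ℕ → Set ℝ := fun k => if k = i then Set.Iic y else Set.Iic z with hBdef
  have hBm : ∀ k, MeasurableSet (B k) := fun k => by
    rw [hBdef]; dsimp only; split_ifs <;> exact measurableSet_Iic
  have hBi : X i ⁻¹' B i = {ω | X i ω ≤ y} := by simp [hBdef, Set.preimage, Set.Iic]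
  have hBj : X j ⁻¹' B j = {ω | X j ω ≤ z} := by simp [hBdef, Set.preimage, Set.Iic, hij.symm]
  have hB : MeasurableSet (⋂ k ∈ ({i, j} : Finset ℕ), X k ⁻¹' B k) :=
    Finset.measurableSet_biInter _ fun k _ => hX.measurable k (hBm k)
  have e1 : (P.restrict A).map (fun ω => (X i ω, X j ω)) (Set.Iic y ×ˢ Set.Iic z)
      = P ((⋂ k ∈ ({i, j} : Finset ℕ), X k ⁻¹' B k) ∩ A) := by
    rw [Measure.map_apply ((hX.measurable i).prodMk (hX.measurable j))
      (measurableSet_Iic.prod measurableSet_Iic), ← Measure.restrict_apply hB]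
    congr 1
    ext ω
    simp [hBdef, hij.symm]
  rw [e1, measure_inter_eq_lintegral_condExp hm hA hB]
  have c1 := ae_mono (Measure.restrict_mono hAi le_rfl) (hX.condCdf i y)
  have c2 := ae_mono (Measure.restrict_mono hAj le_rfl) (hX.condCdf j z)
  have hAij : A ⊆ {ω | ∀ k ∈ ({i, j} : Finset ℕ), arrivalTime V (k + 1) ω ≠ ∞} := by
    intro ω hω k hk
    rcases Finset.mem_insert.1 hk with rfl | hk
    · exact hAi hω
    · rw [Finset.mem_singleton.1 hk]; exact hAj hω
  have c3 := ae_mono (Measure.restrict_mono hAij le_rfl) (hX.condIndep {i, j} B hBm)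
  have e2 : ∫⁻ ω in A, ENNReal.ofReal
        ((P⟦⋂ k ∈ ({i, j} : Finset ℕ), X k ⁻¹' B k | arrivalSigma V⟧) ω) ∂P =
      ∫⁻ ω in A, (loading β (V i ω) * loading β (V j ω) * (Hl (Set.Iic y) * Hl (Set.Iic z))
        + loading β (V i ω) * discount β (V j ω) * (Hl (Set.Iic y) * Hs (Set.Iic z))
        + discount β (V i ω) * loading β (V j ω) * (Hs (Set.Iic y) * Hl (Set.Iic z))
        + discount β (V i ω) * discount β (V j ω) * (Hs (Set.Iic y) * Hs (Set.Iic z))) ∂P := by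
    refine lintegral_congr_ae ?_
    filter_upwards [c1, c2, c3] with ω h1 h2 h3
    rw [h3, Finset.prod_pair hij, hBi, hBj, h1, h2, ENNReal.ofReal_mul (mix_nonneg hβ _ _),
      ofReal_mix hβ, ofReal_mix hβ]
    ring
  have hlm : ∀ k, Measurable fun ω => loading β (V k ω) :=
    fun k => (measurable_loading β).comp (hV k)
  have hdm : ∀ k, Measurable fun ω => discount β (V k ω) :=
    fun k => (measurable_discount β).comp (hV k)
  rw [e2, lintegral_add_left (by fun_prop), lintegral_add_left (by fun_prop),
    lintegral_add_left (by fun_prop), lintegral_mul_const _ (by fun_prop),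
    lintegral_mul_const _ (by fun_prop), lintegral_mul_const _ (by fun_prop),
    lintegral_mul_const _ (by fun_prop)]
  simp only [Measure.add_apply, Measure.smul_apply, smul_eq_mul, Measure.prod_prod]

end IsBoudreaultModel

end

/-! ### The squared aggregate claim as a double sum -/

section
variable {Ω : Type*} [MeasurableSpace Ω] {P : Measure Ω} {V : ℕ → Ω → ℝ≥0∞} {X : ℕ → Ω → ℝ}
  {β t : ℝ} {Hl Hs : Measure ℝ}

/-- The event that the claims `z.1` and `z.2` both arrive up to time `t`. -/
def jointEvent {Ω : Type*} (V : ℕ → Ω → ℝ≥0∞) (t : ℝ) (z : ℕ × ℕ) : Set Ω :=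
  {ω | arrivalTime V (max z.1 z.2 + 1) ω ≤ ENNReal.ofReal t}

lemma arrivalTime_mono {Ω : Type*} (V : ℕ → Ω → ℝ≥0∞) {m n : ℕ} (h : m ≤ n) (ω : Ω) :
    arrivalTime V m ω ≤ arrivalTime V n ω :=
  Finset.sum_le_sum_of_subset (Finset.range_subset_range.2 h)

lemma mem_jointEvent {Ω : Type*} {V : ℕ → Ω → ℝ≥0∞} {z : ℕ × ℕ} {ω : Ω} : ω ∈ jointEvent V t z ↔
    arrivalTime V (z.1 + 1) ω ≤ ENNReal.ofReal t ∧ arrivalTime V (z.2 + 1) ω ≤ ENNReal.ofReal t := by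
  refine ⟨fun h => ⟨(arrivalTime_mono V (by simp) ω).trans h,
    (arrivalTime_mono V (by simp) ω).trans h⟩, fun h => ?_⟩
  rcases max_choice z.1 z.2 with e | e <;> simp only [jointEvent, Set.mem_ofPred_eq, e, h]

lemma measurableSet_jointEvent (hV : ∀ i, Measurable (V i)) (z : ℕ × ℕ) :
    MeasurableSet (jointEvent V t z) :=
  measurableSet_arrivalTime_le hV _ _

/-- The contribution of the diagonal to a double sum over claims. -/
noncomputable def diagWeight {Ω : Type*} [MeasurableSpace Ω] (P : Measure Ω) (V : ℕ → Ω → ℝ≥0∞)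
    (t : ℝ) (g : ℝ≥0∞ → ℝ≥0∞) (z : ℕ × ℕ) : ℝ≥0∞ :=
  if z.1 = z.2 then singleWeight P V t g z.1 else 0

lemma tsum_diagWeight (g : ℝ≥0∞ → ℝ≥0∞) :
    ∑' z, diagWeight P V t g z = ∑' i, singleWeight P V t g i := by
  rw [ENNReal.tsum_prod']
  refine tsum_congr fun i => ?_
  rw [tsum_eq_single i fun j hj => by simp [diagWeight, hj.symm]]
  simp [diagWeight]

variable [IsProbabilityMeasure P] [IsProbabilityMeasure Hl] [IsProbabilityMeasure Hs]

namespace IsBoudreaultModel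

lemma map_jointEvent_diag (hX : IsBoudreaultModel P V X β Hl Hs) (hV : ∀ i, Measurable (V i))
    (hβ : 0 ≤ β) (i : ℕ) :
    (P.restrict {ω | arrivalTime V (i + 1) ω ≤ ENNReal.ofReal t}).map (X i) =
      singleWeight P V t (loading β) i • Hl + singleWeight P V t (discount β) i • Hs :=
  hX.map_restrict hV hβ (measurableSet_arrivalSigma_le _ _)
    (fun _ h => (lt_of_le_of_lt h ENNReal.ofReal_lt_top).ne)

lemma map_jointEvent (hX : IsBoudreaultModel P V X β Hl Hs) (hV : ∀ i, Measurable (V i))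
    (hβ : 0 ≤ β) {z : ℕ × ℕ} (hz : z.1 ≠ z.2) :
    (P.restrict (jointEvent V t z)).map (fun ω => (X z.1 ω, X z.2 ω)) =
      pairWeight P V t (loading β) (loading β) z • Hl.prod Hl
      + pairWeight P V t (loading β) (discount β) z • Hl.prod Hs
      + pairWeight P V t (discount β) (loading β) z • Hs.prod Hl
      + pairWeight P V t (discount β) (discount β) z • Hs.prod Hs := by
  simp only [pairWeight, if_neg hz]
  exact hX.map_restrict_pair hV hβ (measurableSet_arrivalSigma_le _ _) hz
    (fun _ h => ((mem_jointEvent.1 h).1.trans_lt ENNReal.ofReal_lt_top).ne)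
    (fun _ h => ((mem_jointEvent.1 h).2.trans_lt ENNReal.ofReal_lt_top).ne)

/-- The function `φ` is general because two choices are needed: `ENNReal.ofReal` for nonnegative
claims, and the norm for absolute convergence with signed claims. -/
lemma setLIntegral_mul (hX : IsBoudreaultModel P V X β Hl Hs) (hV : ∀ i, Measurable (V i))
    (hβ : 0 ≤ β) {φ : ℝ → ℝ≥0∞} (hφ : Measurable φ) (z : ℕ × ℕ) :
    ∫⁻ ω in jointEvent V t z, φ (X z.1 ω) * φ (X z.2 ω) ∂P =
      diagWeight P V t (loading β) z * (∫⁻ y, φ y * φ y ∂Hl)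
      + diagWeight P V t (discount β) z * (∫⁻ y, φ y * φ y ∂Hs)
      + pairWeight P V t (loading β) (loading β) z * ((∫⁻ y, φ y ∂Hl) * ∫⁻ y, φ y ∂Hl)
      + pairWeight P V t (loading β) (discount β) z * ((∫⁻ y, φ y ∂Hl) * ∫⁻ y, φ y ∂Hs)
      + pairWeight P V t (discount β) (loading β) z * ((∫⁻ y, φ y ∂Hs) * ∫⁻ y, φ y ∂Hl)
      + pairWeight P V t (discount β) (discount β) z * ((∫⁻ y, φ y ∂Hs) * ∫⁻ y, φ y ∂Hs) := by
  obtain ⟨i, j⟩ := z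
  by_cases hz : i = j
  · subst hz
    simp only [diagWeight, pairWeight, if_true, zero_mul, add_zero]
    have := hX.map_jointEvent_diag (t := t) hV hβ i
    have h2 : ∫⁻ ω in jointEvent V t (i, i), φ (X i ω) * φ (X i ω) ∂P = ∫⁻ y, φ y * φ y
        ∂((P.restrict {ω | arrivalTime V (i + 1) ω ≤ ENNReal.ofReal t}).map (X i)) := by
      rw [lintegral_map (f := fun y => φ y * φ y) (by fun_prop) (hX.measurable i)]
      simp [jointEvent]
    rw [h2, this, lintegral_add_measure, lintegral_smul_measure, lintegral_smul_measure,
      smul_eq_mul, smul_eq_mul]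
  · have h1 : ∫⁻ ω in jointEvent V t (i, j), φ (X i ω) * φ (X j ω) ∂P = ∫⁻ p, φ p.1 * φ p.2
        ∂((P.restrict (jointEvent V t (i, j))).map (fun ω => (X i ω, X j ω))) := by
      rw [lintegral_map (by fun_prop) ((hX.measurable i).prodMk (hX.measurable j))]
    simp only [diagWeight, if_neg hz, zero_mul, zero_add]
    rw [h1, hX.map_jointEvent hV hβ (z := (i, j)) hz]
    simp only [lintegral_add_measure, lintegral_smul_measure, smul_eq_mul,
      lintegral_prod_mul hφ.aemeasurable hφ.aemeasurable]

lemma setIntegral_mul (hX : IsBoudreaultModel P V X β Hl Hs) (hV : ∀ i, Measurable (V i))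
    (hβ : 0 ≤ β) (hl : MemLp (fun y : ℝ => y) 2 Hl) (hs : MemLp (fun y : ℝ => y) 2 Hs)
    (z : ℕ × ℕ) :
    ∫ ω in jointEvent V t z, X z.1 ω * X z.2 ω ∂P =
      (diagWeight P V t (loading β) z).toReal * (∫ y, y ^ 2 ∂Hl)
      + (diagWeight P V t (discount β) z).toReal * (∫ y, y ^ 2 ∂Hs)
      + (pairWeight P V t (loading β) (loading β) z).toReal * ((∫ y, y ∂Hl) * ∫ y, y ∂Hl)
      + (pairWeight P V t (loading β) (discount β) z).toReal * ((∫ y, y ∂Hl) * ∫ y, y ∂Hs)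
      + (pairWeight P V t (discount β) (loading β) z).toReal * ((∫ y, y ∂Hs) * ∫ y, y ∂Hl)
      + (pairWeight P V t (discount β) (discount β) z).toReal * ((∫ y, y ∂Hs) * ∫ y, y ∂Hs) := by
  have hL := fun v => loading_le_one β v
  have hD := fun v => discount_le_one hβ v
  have hl1 := hl.integrable one_le_two
  have hs1 := hs.integrable one_le_two
  obtain ⟨i, j⟩ := z
  by_cases hz : i = j
  · subst hz
    simp only [diagWeight, pairWeight, if_true, zero_mul, add_zero, ENNReal.toReal_zero]
    have := hX.map_jointEvent_diag (t := t) hV hβ i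
    have h2 : ∫ ω in jointEvent V t (i, i), X i ω * X i ω ∂P = ∫ y, y ^ 2
        ∂((P.restrict {ω | arrivalTime V (i + 1) ω ≤ ENNReal.ofReal t}).map (X i)) := by
      rw [integral_map (hX.measurable i).aemeasurable (by fun_prop)]
      simp [jointEvent, sq]
    have k1 : singleWeight P V t (loading β) i ≠ ∞ :=
      setLIntegral_ne_top_of_le_one (fun ω => hL _) _
    have k2 : singleWeight P V t (discount β) i ≠ ∞ :=
      setLIntegral_ne_top_of_le_one (fun ω => hD _) _
    rw [h2, this, integral_add_measure
      (hl.integrable_sq.smul_measure k1) (hs.integrable_sq.smul_measure k2),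
      integral_smul_measure, integral_smul_measure, smul_eq_mul, smul_eq_mul]
  · have h1 : ∫ ω in jointEvent V t (i, j), X i ω * X j ω ∂P = ∫ p, p.1 * p.2
        ∂((P.restrict (jointEvent V t (i, j))).map (fun ω => (X i ω, X j ω))) := by
      rw [integral_map ((hX.measurable i).prodMk (hX.measurable j)).aemeasurable
        (Measurable.aestronglyMeasurable (by fun_prop))]
    have hne : ∀ {g h : ℝ≥0∞ → ℝ≥0∞}, (∀ v, g v ≤ 1) → (∀ v, h v ≤ 1) →
        pairWeight P V t g h (i, j) ≠ ∞ := fun hg hh => by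
      simp only [pairWeight, if_neg hz]
      exact setLIntegral_ne_top_of_le_one (fun ω => mul_le_one' (hg _) (hh _)) _
    have k1 := (hl1.mul_prod hl1).smul_measure (hne hL hL)
    have k2 := (hl1.mul_prod hs1).smul_measure (hne hL hD)
    have k3 := (hs1.mul_prod hl1).smul_measure (hne hD hL)
    have k4 := (hs1.mul_prod hs1).smul_measure (hne hD hD)
    simp only [diagWeight, if_neg hz, zero_mul, zero_add, ENNReal.toReal_zero]
    rw [h1, hX.map_jointEvent hV hβ (z := (i, j)) hz,
      integral_add_measure ((k1.add_measure k2).add_measure k3) k4,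
      integral_add_measure (k1.add_measure k2) k3, integral_add_measure k1 k2]
    simp only [integral_smul_measure, smul_eq_mul, integral_prod_mul (fun y : ℝ => y) fun y => y]

end IsBoudreaultModel

/-- The square of the aggregate claim as a double sum over all claims. -/
lemma hasSum_sq_aggregateClaim {Ω : Type*} {V : ℕ → Ω → ℝ≥0∞} {X : ℕ → Ω → ℝ} {ω : Ω}
    (hω : {i | arrivalTime V (i + 1) ω ≤ ENNReal.ofReal t}.Finite) :
    HasSum (fun z : ℕ × ℕ => (jointEvent V t z).indicator (fun ω => X z.1 ω * X z.2 ω) ω)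
      (aggregateClaim V X t ω ^ 2) := by
  set I := {i | arrivalTime V (i + 1) ω ≤ ENNReal.ofReal t} with hI
  have hdown : ∀ i ∈ I, ∀ j ≤ i, j ∈ I := fun i hi j hj =>
    (arrivalTime_mono V (by omega) ω).trans hi
  -- Arrival times are nondecreasing, so the arrived claims form an initial segment. Finiteness
  -- matters: `Set.ncard` of an infinite set is `0`.
  have hIN : ∀ i, i ∈ I ↔ i < claimCount V t ω := by
    have hc : claimCount V t ω = hω.toFinset.card := Set.ncard_eq_toFinset_card I hω
    intro i
    rw [hc]
    constructor
    · intro hi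
      have : Finset.range (i + 1) ⊆ hω.toFinset := fun j hj =>
        hω.mem_toFinset.2 (hdown i hi j (Nat.lt_succ_iff.1 (Finset.mem_range.1 hj)))
      simpa using Finset.card_le_card this
    · intro hi
      by_contra hn
      have : hω.toFinset ⊆ Finset.range i := fun j hj => by
        rw [Finset.mem_range]
        by_contra hji
        exact hn (hdown j (hω.mem_toFinset.1 hj) i (not_lt.1 hji))
      have := Finset.card_le_card this
      rw [Finset.card_range] at this
      omega
  have hmem : ∀ z : ℕ × ℕ, ω ∈ jointEvent V t z ↔
      z ∈ Finset.range (claimCount V t ω) ×ˢ Finset.range (claimCount V t ω) := by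
    intro z
    rw [mem_jointEvent, Finset.mem_product, Finset.mem_range, Finset.mem_range, ← hIN, ← hIN]
    rfl
  have h : aggregateClaim V X t ω ^ 2 =
      ∑ z ∈ Finset.range (claimCount V t ω) ×ˢ Finset.range (claimCount V t ω),
        (jointEvent V t z).indicator (fun ω => X z.1 ω * X z.2 ω) ω := by
    rw [aggregateClaim, sq, Finset.sum_mul_sum, ← Finset.sum_product']
    exact Finset.sum_congr rfl fun z hz => by rw [Set.indicator_of_mem ((hmem z).2 hz)]
  rw [h]
  exact hasSum_sum_of_ne_finset_zero fun z hz =>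
    Set.indicator_of_notMem (fun hc => hz ((hmem z).1 hc)) _

variable {L : Measure ℝ≥0} [IsProbabilityMeasure L]

lemma tsum_setLIntegral_mul (hV : IsMixedPoisson P L V) (hX : IsBoudreaultModel P V X β Hl Hs)
    (hβ : 0 ≤ β) (ht : 0 ≤ t) {φ : ℝ → ℝ≥0∞} (hφ : Measurable φ) :
    ∑' z, ∫⁻ ω in jointEvent V t z, φ (X z.1 ω) * φ (X z.2 ω) ∂P =
      (∫⁻ y, φ y * φ y ∂Hl) * (∫⁻ l : ℝ≥0, ENNReal.ofReal ((l : ℝ) * t - frakA t l β) ∂L)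
      + (∫⁻ y, φ y * φ y ∂Hs) * (∫⁻ l : ℝ≥0, ENNReal.ofReal (frakA t l β) ∂L)
      + (∫⁻ y, φ y ∂Hl) ^ 2 * (∫⁻ l : ℝ≥0, ENNReal.ofReal (coeffLL t l β) ∂L)
      + 2 * (∫⁻ y, φ y ∂Hl) * (∫⁻ y, φ y ∂Hs) * (∫⁻ l : ℝ≥0, ENNReal.ofReal (coeffLS t l β) ∂L)
      + (∫⁻ y, φ y ∂Hs) ^ 2 * (∫⁻ l : ℝ≥0, ENNReal.ofReal (frakBdiag t l β) ∂L) := by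
  simp_rw [hX.setLIntegral_mul hV.measurable hβ hφ]
  simp_rw [ENNReal.tsum_add, ENNReal.tsum_mul_right, tsum_diagWeight,
    tsum_pairWeight_comm (loading β) (discount β)]
  rw [hV.tsum_singleWeight_loading hβ ht, hV.tsum_singleWeight_discount hβ ht,
    hV.tsum_pairWeight_loading_loading hβ ht, hV.tsum_pairWeight_discount_loading hβ ht,
    hV.tsum_pairWeight_discount_discount hβ ht]
  ring

lemma lintegral_ofReal_sq_aggregateClaim (hV : IsMixedPoisson P L V)
    (hX : IsBoudreaultModel P V X β Hl Hs) (hβ : 0 ≤ β) (ht : 0 ≤ t)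
    (hl : Hl (Set.Iio 0) = 0) (hs : Hs (Set.Iio 0) = 0) :
    ∫⁻ ω, ENNReal.ofReal (aggregateClaim V X t ω ^ 2) ∂P =
      ∑' z, ∫⁻ ω in jointEvent V t z, ENNReal.ofReal (X z.1 ω) * ENNReal.ofReal (X z.2 ω) ∂P := by
  -- Nonnegativity can be claimed only for claims that arrive, as the model leaves the other `X i`
  -- free; only arrived claims enter the sum.
  have hpos : ∀ᵐ ω ∂P, ∀ i, arrivalTime V (i + 1) ω ≤ ENNReal.ofReal t → 0 ≤ X i ω := by
    rw [ae_all_iff]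
    intro i
    have h := congrArg (fun μ => μ (Set.Iio 0)) (hX.map_jointEvent_diag (t := t) hV.measurable hβ i)
    simp only [Measure.add_apply, Measure.smul_apply, hl, hs, smul_zero, add_zero] at h
    rw [Measure.map_apply (hX.measurable i) measurableSet_Iio] at h
    have h2 : ∀ᵐ ω ∂(P.restrict {ω | arrivalTime V (i + 1) ω ≤ ENNReal.ofReal t}), 0 ≤ X i ω := by
      rw [ae_iff]
      simp only [not_le]
      exact h
    exact (ae_restrict_iff' (measurableSet_arrivalTime_le hV.measurable _ _)).1 h2
  have hm : ∀ z : ℕ × ℕ, Measurable fun ω => ENNReal.ofReal (X z.1 ω) * ENNReal.ofReal (X z.2 ω) :=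
    fun z => (hX.measurable _).ennreal_ofReal.mul (hX.measurable _).ennreal_ofReal
  simp_rw [← fun z => lintegral_indicator (μ := P)
    (measurableSet_jointEvent (t := t) hV.measurable z)
    (fun ω => ENNReal.ofReal (X z.1 ω) * ENNReal.ofReal (X z.2 ω))]
  rw [← lintegral_tsum fun z => ((hm z).indicator
    (measurableSet_jointEvent hV.measurable z)).aemeasurable]
  refine lintegral_congr_ae ?_
  filter_upwards [hpos, hV.ae_finite ht] with ω h1 h2
  have hsum := hasSum_sq_aggregateClaim (X := X) h2
  rw [← hsum.tsum_eq, ENNReal.ofReal_tsum_of_nonneg _ hsum.summable]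
  · refine tsum_congr fun z => ?_
    by_cases hz : ω ∈ jointEvent V t z
    · rw [Set.indicator_of_mem hz, Set.indicator_of_mem hz,
        ENNReal.ofReal_mul (h1 _ (mem_jointEvent.1 hz).1)]
    · rw [Set.indicator_of_notMem hz, Set.indicator_of_notMem hz, ENNReal.ofReal_zero]
  · intro z
    by_cases hz : ω ∈ jointEvent V t z
    · rw [Set.indicator_of_mem hz]
      exact mul_nonneg (h1 _ (mem_jointEvent.1 hz).1) (h1 _ (mem_jointEvent.1 hz).2)
    · rw [Set.indicator_of_notMem hz]

end

/-! ### Integrability of the coefficients in the rate -/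

section
variable {β t : ℝ} {L : Measure ℝ≥0}

lemma integrable_of_integrable_sq [IsFiniteMeasure L] (hL : Integrable (fun l : ℝ≥0 => (l : ℝ) ^ 2) L) :
    Integrable (fun l : ℝ≥0 => (l : ℝ)) L := by
  refine ((integrable_const (1 : ℝ)).add hL).mono' (by fun_prop)
    (Filter.Eventually.of_forall fun l => ?_)
  rw [Real.norm_of_nonneg (by positivity), Pi.add_apply]
  nlinarith [sq_nonneg ((l : ℝ) - 1), l.2]

lemma integrable_of_nonneg_of_le {f g : ℝ≥0 → ℝ} (hf : Measurable f) (hg : Integrable g L)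
    (h0 : ∀ l, 0 ≤ f l) (h : ∀ l, f l ≤ g l) : Integrable f L :=
  hg.mono' hf.aestronglyMeasurable
    (Filter.Eventually.of_forall fun l => by rw [Real.norm_of_nonneg (h0 l)]; exact h l)

lemma measurable_frakA (t β : ℝ) : Measurable fun l : ℝ≥0 => frakA t l β := by
  unfold frakA; fun_prop

lemma measurable_frakBdiag (t β : ℝ) : Measurable fun l : ℝ≥0 => frakBdiag t l β := by
  unfold frakBdiag; fun_prop

lemma measurable_coeffLS (t β : ℝ) : Measurable fun l : ℝ≥0 => coeffLS t l β := by
  unfold coeffLS frakBmixed frakBdiag; fun_prop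

lemma measurable_coeffLL (t β : ℝ) : Measurable fun l : ℝ≥0 => coeffLL t l β := by
  unfold coeffLL frakBzero frakBmixed frakBdiag; fun_prop

lemma integrable_frakA [IsFiniteMeasure L] (hL : Integrable (fun l : ℝ≥0 => (l : ℝ) ^ 2) L) (hβ : 0 ≤ β)
    (ht : 0 ≤ t) : Integrable (fun l : ℝ≥0 => frakA t l β) L :=
  integrable_of_nonneg_of_le (measurable_frakA t β)
    ((integrable_of_integrable_sq hL).mul_const t) (frakA_nonneg hβ ht)
    fun l => sub_nonneg.1 (nonneg_and_tsum_singleWeight_loading hβ ht l).1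

/-- Since the terms are nonnegative, each coefficient is at most `l² t²`, hence integrable when the
second moment of `L` is finite. -/
lemma coeff_sum_eq (t l β : ℝ) :
    coeffLL t l β + 2 * coeffLS t l β + frakBdiag t l β = l ^ 2 * t ^ 2 := by
  unfold coeffLL coeffLS frakBzero; ring

lemma integrable_coeffLL (hL : Integrable (fun l : ℝ≥0 => (l : ℝ) ^ 2) L) (hβ : 0 ≤ β)
    (ht : 0 ≤ t) : Integrable (fun l : ℝ≥0 => coeffLL t l β) L :=
  integrable_of_nonneg_of_le (measurable_coeffLL t β) (hL.mul_const (t ^ 2))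
    (fun l => (nonneg_and_tsum_pairWeight_loading_loading hβ ht l).1) fun l => by
      have := (nonneg_and_tsum_pairWeight_discount_loading hβ ht l).1
      linarith [coeff_sum_eq t l β, frakBdiag_nonneg hβ ht l]

lemma integrable_coeffLS (hL : Integrable (fun l : ℝ≥0 => (l : ℝ) ^ 2) L) (hβ : 0 ≤ β)
    (ht : 0 ≤ t) : Integrable (fun l : ℝ≥0 => coeffLS t l β) L :=
  integrable_of_nonneg_of_le (measurable_coeffLS t β) (hL.mul_const (t ^ 2))
    (fun l => (nonneg_and_tsum_pairWeight_discount_loading hβ ht l).1) fun l => by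
      have := (nonneg_and_tsum_pairWeight_discount_loading hβ ht l).1
      linarith [coeff_sum_eq t l β, frakBdiag_nonneg hβ ht l,
        (nonneg_and_tsum_pairWeight_loading_loading hβ ht l).1]

lemma integrable_frakBdiag (hL : Integrable (fun l : ℝ≥0 => (l : ℝ) ^ 2) L) (hβ : 0 ≤ β)
    (ht : 0 ≤ t) : Integrable (fun l : ℝ≥0 => frakBdiag t l β) L :=
  integrable_of_nonneg_of_le (measurable_frakBdiag t β) (hL.mul_const (t ^ 2))
    (frakBdiag_nonneg hβ ht) fun l => by
      have := (nonneg_and_tsum_pairWeight_discount_loading hβ ht l).1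
      linarith [coeff_sum_eq t l β, (nonneg_and_tsum_pairWeight_loading_loading hβ ht l).1]

end

/-- Weights whose sum is the integral of a nonnegative integrable function sum to that integral. -/
lemma hasSum_toReal_of_tsum_eq {ι : Type*} {w : ι → ℝ≥0∞} {L : Measure ℝ≥0} {f : ℝ≥0 → ℝ}
    (hf : Integrable f L) (h0 : ∀ l, 0 ≤ f l) (h : ∑' z, w z = ∫⁻ l, ENNReal.ofReal (f l) ∂L) :
    HasSum (fun z => (w z).toReal) (∫ l, f l ∂L) := by
  have hfin : ∑' z, w z ≠ ∞ := h ▸ hf.lintegral_lt_top.ne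
  have := ENNReal.hasSum_toReal hfin
  rwa [← ENNReal.tsum_toReal_eq fun z => ENNReal.ne_top_of_tsum_ne_top hfin z, h,
    ← integral_eq_lintegral_of_nonneg_ae (Filter.Eventually.of_forall h0)
      hf.aestronglyMeasurable] at this

/-! ### The identity between real numbers -/

section
variable {Ω : Type*} [MeasurableSpace Ω] {P : Measure Ω} [IsProbabilityMeasure P]
  {L : Measure ℝ≥0} [IsProbabilityMeasure L] {V : ℕ → Ω → ℝ≥0∞} {X : ℕ → Ω → ℝ}
  {β t : ℝ} {Hl Hs : Measure ℝ} [IsProbabilityMeasure Hl] [IsProbabilityMeasure Hs]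

lemma lintegral_enorm_mul_self_ne_top {H : Measure ℝ} (h : MemLp (fun y : ℝ => y) 2 H) :
    ∫⁻ y, ‖y‖ₑ * ‖y‖ₑ ∂H ≠ ∞ := by
  have := h.integrable_sq.2
  rw [hasFiniteIntegral_iff_enorm] at this
  simpa [sq, enorm_mul] using this.ne

lemma tsum_setLIntegral_enorm_ne_top (hV : IsMixedPoisson P L V)
    (hX : IsBoudreaultModel P V X β Hl Hs) (hβ : 0 ≤ β) (ht : 0 ≤ t)
    (hl : MemLp (fun y : ℝ => y) 2 Hl) (hs : MemLp (fun y : ℝ => y) 2 Hs)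
    (hL : Integrable (fun l : ℝ≥0 => (l : ℝ) ^ 2) L) :
    ∑' z, ∫⁻ ω in jointEvent V t z, ‖X z.1 ω‖ₑ * ‖X z.2 ω‖ₑ ∂P ≠ ∞ := by
  rw [tsum_setLIntegral_mul hV hX hβ ht measurable_enorm]
  have hl1 := (hl.integrable one_le_two).2
  have hs1 := (hs.integrable one_le_two).2
  rw [hasFiniteIntegral_iff_enorm] at hl1 hs1
  have i1 := (((integrable_of_integrable_sq hL).mul_const t).sub
    (integrable_frakA hL hβ ht)).lintegral_lt_top.ne
  have i2 := (integrable_frakA hL hβ ht).lintegral_lt_top.ne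
  have i3 := (integrable_coeffLL hL hβ ht).lintegral_lt_top.ne
  have i4 := (integrable_coeffLS hL hβ ht).lintegral_lt_top.ne
  have i5 := (integrable_frakBdiag hL hβ ht).lintegral_lt_top.ne
  refine ENNReal.add_ne_top.2 ⟨ENNReal.add_ne_top.2 ⟨ENNReal.add_ne_top.2
    ⟨ENNReal.add_ne_top.2 ⟨?_, ?_⟩, ?_⟩, ?_⟩, ?_⟩
  · exact ENNReal.mul_ne_top (lintegral_enorm_mul_self_ne_top hl) i1
  · exact ENNReal.mul_ne_top (lintegral_enorm_mul_self_ne_top hs) i2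
  · exact ENNReal.mul_ne_top (ENNReal.pow_ne_top hl1.ne) i3
  · exact ENNReal.mul_ne_top (ENNReal.mul_ne_top (ENNReal.mul_ne_top (by simp) hl1.ne) hs1.ne) i4
  · exact ENNReal.mul_ne_top (ENNReal.pow_ne_top hs1.ne) i5

lemma integrable_sq_aggregateClaim_and_integral_eq (hV : IsMixedPoisson P L V)
    (hX : IsBoudreaultModel P V X β Hl Hs) (hβ : 0 ≤ β) (ht : 0 ≤ t)
    (hl : MemLp (fun y : ℝ => y) 2 Hl) (hs : MemLp (fun y : ℝ => y) 2 Hs)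
    (hL : Integrable (fun l : ℝ≥0 => (l : ℝ) ^ 2) L) :
    Integrable (fun ω => aggregateClaim V X t ω ^ 2) P ∧
      ∫ ω, aggregateClaim V X t ω ^ 2 ∂P =
        ∑' z, ∫ ω in jointEvent V t z, X z.1 ω * X z.2 ω ∂P := by
  set f : ℕ × ℕ → Ω → ℝ := fun z => (jointEvent V t z).indicator fun ω => X z.1 ω * X z.2 ω with hf
  have hfm : ∀ z, Measurable (f z) := fun z =>
    ((hX.measurable _).mul (hX.measurable _)).indicator (measurableSet_jointEvent hV.measurable z)
  have hfin : ∑' z, ∫⁻ ω, ‖f z ω‖ₑ ∂P ≠ ∞ := by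
    convert tsum_setLIntegral_enorm_ne_top hV hX hβ ht hl hs hL using 3 with z
    rw [← lintegral_indicator (measurableSet_jointEvent hV.measurable z)]
    refine lintegral_congr fun ω => ?_
    rw [hf, enorm_indicator_eq_indicator_enorm]
    simp only [enorm_mul]
  have hsum : (fun ω => aggregateClaim V X t ω ^ 2) =ᵐ[P] fun ω => ∑' z, f z ω := by
    filter_upwards [hV.ae_finite ht] with ω hω
    exact (hasSum_sq_aggregateClaim hω).tsum_eq.symm
  constructor
  · refine Integrable.congr ⟨(Measurable.tsum hfm).aestronglyMeasurable, ?_⟩ hsum.symm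
    rw [hasFiniteIntegral_iff_enorm]
    refine (lintegral_mono fun ω => enorm_tsum_le_tsum_enorm).trans_lt ?_
    rw [lintegral_tsum fun z => (hfm z).enorm.aemeasurable]
    exact hfin.lt_top
  · rw [integral_congr_ae hsum, integral_tsum (fun z => (hfm z).aestronglyMeasurable) hfin]
    exact tsum_congr fun z => integral_indicator (measurableSet_jointEvent hV.measurable z)

lemma tsum_setIntegral_mul (hV : IsMixedPoisson P L V)
    (hX : IsBoudreaultModel P V X β Hl Hs) (hβ : 0 ≤ β) (ht : 0 ≤ t)
    (hl : MemLp (fun y : ℝ => y) 2 Hl) (hs : MemLp (fun y : ℝ => y) 2 Hs)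
    (hL : Integrable (fun l : ℝ≥0 => (l : ℝ) ^ 2) L) :
    ∑' z, ∫ ω in jointEvent V t z, X z.1 ω * X z.2 ω ∂P =
      (∫ y, y ^ 2 ∂Hl) * (∫ l : ℝ≥0, ((l : ℝ) * t - frakA t l β) ∂L)
      + (∫ y, y ^ 2 ∂Hs) * (∫ l : ℝ≥0, frakA t l β ∂L)
      + (∫ y, y ∂Hl) ^ 2 * (∫ l : ℝ≥0, coeffLL t l β ∂L)
      + 2 * (∫ y, y ∂Hl) * (∫ y, y ∂Hs) * (∫ l : ℝ≥0, coeffLS t l β ∂L)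
      + (∫ y, y ∂Hs) ^ 2 * (∫ l : ℝ≥0, frakBdiag t l β ∂L) := by
  have s1 := hasSum_toReal_of_tsum_eq
    (((integrable_of_integrable_sq hL).mul_const t).sub (integrable_frakA hL hβ ht))
    (fun l => (nonneg_and_tsum_singleWeight_loading hβ ht l).1)
    ((tsum_diagWeight _).trans (hV.tsum_singleWeight_loading hβ ht))
  have s2 := hasSum_toReal_of_tsum_eq (integrable_frakA hL hβ ht) (frakA_nonneg hβ ht)
    ((tsum_diagWeight _).trans (hV.tsum_singleWeight_discount hβ ht))
  have s3 := hasSum_toReal_of_tsum_eq (integrable_coeffLL hL hβ ht)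
    (fun l => (nonneg_and_tsum_pairWeight_loading_loading hβ ht l).1)
    (hV.tsum_pairWeight_loading_loading hβ ht)
  have s4 := hasSum_toReal_of_tsum_eq (integrable_coeffLS hL hβ ht)
    (fun l => (nonneg_and_tsum_pairWeight_discount_loading hβ ht l).1)
    (hV.tsum_pairWeight_discount_loading hβ ht)
  have s5 := hasSum_toReal_of_tsum_eq (integrable_coeffLS hL hβ ht)
    (fun l => (nonneg_and_tsum_pairWeight_discount_loading hβ ht l).1)
    ((tsum_pairWeight_comm _ _).trans (hV.tsum_pairWeight_discount_loading hβ ht))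
  have s6 := hasSum_toReal_of_tsum_eq (integrable_frakBdiag hL hβ ht) (frakBdiag_nonneg hβ ht)
    (hV.tsum_pairWeight_discount_discount hβ ht)
  simp_rw [hX.setIntegral_mul hV.measurable hβ hl hs]
  -- The loading–discount sum `s5` precedes the discount–loading sum `s4`, as in `setIntegral_mul`;
  -- both equal the integral of `coeffLS`, whence the factor `2`.
  refine (((((((s1.mul_right _).add (s2.mul_right _)).add (s3.mul_right _)).add
    (s5.mul_right _)).add (s4.mul_right _)).add (s6.mul_right _)).tsum_eq).trans ?_
  simp only [Pi.sub_apply]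
  ring

lemma lintegral_ofReal_mul_self {H : Measure ℝ} (h : H (Set.Iio 0) = 0) :
    ∫⁻ y, ENNReal.ofReal y * ENNReal.ofReal y ∂H = ∫⁻ y, ENNReal.ofReal (y ^ 2) ∂H := by
  have h0 : ∀ᵐ y ∂H, 0 ≤ y := by
    rw [ae_iff]
    simp only [not_le]
    exact h
  refine lintegral_congr_ae ?_
  filter_upwards [h0] with y hy
  rw [sq, ENNReal.ofReal_mul hy]

end

end AggregateClaims

theorem mainTheorem6 {Ω : Type*} [MeasurableSpace Ω] (P : Measure Ω) [IsProbabilityMeasure P]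
    (L : Measure ℝ≥0) [IsProbabilityMeasure L]
    (Hl Hs : Measure ℝ) [IsProbabilityMeasure Hl] [IsProbabilityMeasure Hs]
    (β : ℝ) (hβ : 0 ≤ β)
    (V : ℕ → Ω → ℝ≥0∞) (X : ℕ → Ω → ℝ)
    (hV : AggregateClaims.IsMixedPoisson P L V)
    (hX : AggregateClaims.IsBoudreaultModel P V X β Hl Hs)
    (t : ℝ) (ht : 0 ≤ t) :
    -- finite moments
    (MemLp (fun y : ℝ => y) 2 Hl → MemLp (fun y : ℝ => y) 2 Hs →
      Integrable (fun l : ℝ≥0 => (l : ℝ) ^ 2) L →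
        Integrable (fun ω => AggregateClaims.aggregateClaim V X t ω ^ 2) P ∧
        Integrable (fun l : ℝ≥0 => (l : ℝ) * t - AggregateClaims.frakA t l β) L ∧
        Integrable (fun l : ℝ≥0 => AggregateClaims.frakA t l β) L ∧
        Integrable (fun l : ℝ≥0 => AggregateClaims.coeffLL t l β) L ∧
        Integrable (fun l : ℝ≥0 => AggregateClaims.coeffLS t l β) L ∧
        Integrable (fun l : ℝ≥0 => AggregateClaims.frakBdiag t l β) L ∧
        ∫ ω, AggregateClaims.aggregateClaim V X t ω ^ 2 ∂P =
          (∫ y, y ^ 2 ∂Hl) * (∫ l : ℝ≥0, ((l : ℝ) * t - AggregateClaims.frakA t l β) ∂L)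
          + (∫ y, y ^ 2 ∂Hs) * (∫ l : ℝ≥0, AggregateClaims.frakA t l β ∂L)
          + (∫ y, y ∂Hl) ^ 2 * (∫ l : ℝ≥0, AggregateClaims.coeffLL t l β ∂L)
          + 2 * (∫ y, y ∂Hl) * (∫ y, y ∂Hs) * (∫ l : ℝ≥0, AggregateClaims.coeffLS t l β ∂L)
          + (∫ y, y ∂Hs) ^ 2 * (∫ l : ℝ≥0, AggregateClaims.frakBdiag t l β ∂L)) ∧
    -- nonnegative claims, without any moment assumption: the identity holds in `[0, ∞]`
    (Hl (Set.Iio 0) = 0 → Hs (Set.Iio 0) = 0 →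
        ∫⁻ ω, ENNReal.ofReal (AggregateClaims.aggregateClaim V X t ω ^ 2) ∂P =
          (∫⁻ y, ENNReal.ofReal (y ^ 2) ∂Hl) *
              (∫⁻ l : ℝ≥0, ENNReal.ofReal ((l : ℝ) * t - AggregateClaims.frakA t l β) ∂L)
          + (∫⁻ y, ENNReal.ofReal (y ^ 2) ∂Hs) *
              (∫⁻ l : ℝ≥0, ENNReal.ofReal (AggregateClaims.frakA t l β) ∂L)
          + (∫⁻ y, ENNReal.ofReal y ∂Hl) ^ 2 *
              (∫⁻ l : ℝ≥0, ENNReal.ofReal (AggregateClaims.coeffLL t l β) ∂L)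
          + 2 * (∫⁻ y, ENNReal.ofReal y ∂Hl) * (∫⁻ y, ENNReal.ofReal y ∂Hs) *
              (∫⁻ l : ℝ≥0, ENNReal.ofReal (AggregateClaims.coeffLS t l β) ∂L)
          + (∫⁻ y, ENNReal.ofReal y ∂Hs) ^ 2 *
              (∫⁻ l : ℝ≥0, ENNReal.ofReal (AggregateClaims.frakBdiag t l β) ∂L)) ∧
    -- the integrands over `λ` are nonnegative
    (∀ l : ℝ, 0 ≤ l →
        0 ≤ l * t - AggregateClaims.frakA t l β ∧ 0 ≤ AggregateClaims.frakA t l β ∧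
        0 ≤ AggregateClaims.coeffLL t l β ∧ 0 ≤ AggregateClaims.coeffLS t l β ∧
        0 ≤ AggregateClaims.frakBdiag t l β) ∧
    -- for `β = 0` both explicit formulas for `𝔅` reduce to `𝔅(t, λ, 0, 0) = t² λ²`
    (∀ l : ℝ, 0 ≤ l →
        AggregateClaims.frakBdiag t l 0 = AggregateClaims.frakBzero t l ∧
        AggregateClaims.frakBmixed t l 0 = AggregateClaims.frakBzero t l) := by
  open AggregateClaims in
  refine ⟨fun hl hs hL => ?_, fun hl hs => ?_, fun l hl => ?_, fun l _ =>
    ⟨frakBdiag_zero_right t l, frakBmixed_zero_right t l⟩⟩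
  · obtain ⟨h1, h2⟩ := integrable_sq_aggregateClaim_and_integral_eq hV hX hβ ht hl hs hL
    exact ⟨h1, ((integrable_of_integrable_sq hL).mul_const t).sub (integrable_frakA hL hβ ht),
      integrable_frakA hL hβ ht, integrable_coeffLL hL hβ ht, integrable_coeffLS hL hβ ht,
      integrable_frakBdiag hL hβ ht, h2.trans (tsum_setIntegral_mul hV hX hβ ht hl hs hL)⟩
  · rw [lintegral_ofReal_sq_aggregateClaim hV hX hβ ht hl hs,
      tsum_setLIntegral_mul hV hX hβ ht ENNReal.measurable_ofReal, lintegral_ofReal_mul_self hl,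
      lintegral_ofReal_mul_self hs]
  · lift l to ℝ≥0 using hl
    exact ⟨(nonneg_and_tsum_singleWeight_loading hβ ht l).1, frakA_nonneg hβ ht l,
      (nonneg_and_tsum_pairWeight_loading_loading hβ ht l).1, (nonneg_and_tsum_pairWeight_discount_loading hβ ht l).1,
      frakBdiag_nonneg hβ ht l⟩
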